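/- **Setting.** A *model* of the type theory $\mathbb T_{\Pi,\mathbf B}$ is a category $\mathcal S$ with a terminal object and, in presheaves over $\mathcal S$, a presheaf $\mathsf{Ty}$ of types, a locally representable dependent presheaf $\mathsf{Tm}$ of terms over it (local representability = context extensions), $\Pi$-types with natural isomorphisms $\mathsf{app}:\mathsf{Tm}(\Pi\,A\,B)\simeq((a:\mathsf{Tm}\,A)\to\mathsf{Tm}(B\,a))$, and a type $\mathbf B$ with $\mathsf{true}$, $\mathsf{false}$ and a dependent eliminator satisfying the two $\beta$-equations. Morphisms of models are functors with actions on types and terms that preserve the terminal object and context extensions up to isomorphism and the operations strictly; 2-cells are natural isomorphisms compatible with these actions. A *renaming algebra* over $\mathcal S$ is a category $\mathcal R$ with a terminal object, a functor $F:\mathcal R\to\mathcal S$ preserving it, a locally representable dependent presheaf $\mathsf{Var}$ over $F^*\mathsf{Ty}$, and an action $\mathsf{var}:\mathsf{Var}\,A\to F^*\mathsf{Tm}\,A$ preserving context extensions; morphisms are functors over $\mathcal S$ (up to isomorphism) with a compatible action on variables that preserve the terminal object and context extensions, and 2-cells are compatible natural isomorphisms. Let $\mathbf 0$ be a biinitial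 model and $F:\mathcal{Ren}\to\mathbf 0$ a biinitial renaming algebra over $\mathbf 0$. All categories and presheaves are small; biinitiality of $\mathbf 0$ also refers to models with a large set of objects. A *displayed model without context extensions* $\mathbf 0^\bullet$ over a functor $F:\mathcal C\to\mathbf 0$ consists, in presheaves over $\mathcal C$, of presheaves $\mathsf{Ty}^\bullet$ over $F^*\mathsf{Ty}$ and $\mathsf{Tm}^\bullet\,A^\bullet\,a$ (for $A^\bullet:\mathsf{Ty}^\bullet A$ and $a:F^*\mathsf{Tm}\,A$), with displayed versions of all operations and equations. It *has context extensions* if $\mathcal C$ has a terminal object preserved by $F$ and, for all $A^\bullet$ over $A$, the presheaf of pairs $(a,a^\bullet)$ with $a^\bullet:\mathsf{Tm}^\bullet A^\bullet a$ is locally representable and its first projection preserves context extensions. A *section* of such a model over $G:\mathcal P\to\mathbf 0$ is a functor $S_0:\mathbf 0\to\mathcal P$ with $S_0\cdot G\simeq 1$ and actions on types and terms over this isomorphism that preserve the terminal object, context extensions and all operations. A *factorization* of $\mathbf 0^\bullet$ over $F:\mathcal C\to\mathbf 0$ consists of functors $Y:\mathcal C\to\mathcal P$ (fully faithful) and $G:\mathcal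 P\to\mathbf 0$ with $Y\cdot G\simeq F$, a displayed model with context extensions $\mathbf 0^\dagger$ over $G$, and bijective actions of $Y$ on displayed types and terms that preserve the displayed operations. Given a factorization and a section $S_0$ of $\mathbf 0^\dagger$, the *displayed inserter* $\mathcal I$, with projection $I:\mathcal I\to\mathcal C$, has as objects pairs $(x,\iota)$ of an object $x$ of $\mathcal C$ and $\iota:Yx\to S_0(Fx)$ lying over $\mathrm{id}_{Fx}$, and as morphisms the morphisms of $\mathcal C$ commuting with the $\iota$'s. For $(x,\iota)$ and a type $A$ (resp. term $a$) over $Fx$, let $S_\iota^{\mathsf{Ty}}A$ (resp. $S_\iota^{\mathsf{Tm}}a$) be the unique displayed type (term) of $\mathbf 0^\bullet$ over $x$ that $Y$ sends to $(S_0A)[\iota]$ (resp. $(S_0a)[\iota]$). A *relative section* $S_\alpha$ of the factorization is a section $S_0$ of $\mathbf 0^\dagger$ with a natural transformation $\alpha:Y\Rightarrow F\cdot S_0$ over $1_F$, equivalently a section $\langle\alpha\rangle:x\mapsto(x,\alpha_x)$ of $I$; its action on terms is $S_\alpha^{\mathsf{Tm}}a=S_{\alpha_x}^{\mathsf{Tm}}a$.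 **Lemma (induction principle relative to $\mathcal{Ren}\to\mathbf 0_{\mathbb T_{\Pi,\mathbf B}}$).** Let $\mathbf 0^\bullet$ be a displayed model without context extensions over $F:\mathcal{Ren}\to\mathbf 0$. Then $\mathbf 0^\bullet$ has a factorization, and for every factorization the displayed model $\mathbf 0^\dagger$ has a section. Moreover, for every factorization and every section $S_0$ of $\mathbf 0^\dagger$, suppose given displayed interpretations of variables: for every object $X=(x,\iota)$ of $\mathcal I$, every type $A$ over $Fx$, every $\rho:y\to x$ in $\mathcal{Ren}$ and every variable $a:\mathsf{Var}_y(A[F\rho])$, a displayed term $$\mathsf{var}^\bullet_{X,A}(\rho,a):\mathsf{Tm}^\bullet_y\bigl((S_\iota^{\mathsf{Ty}}A)[\rho]\bigr)(\mathsf{var}\,a),$$ natural in $y$ and in $X\in\mathcal I$. Then there is a relative section $S_\alpha=(S_0,\alpha)$ of the factorization, and it satisfies, for every object $x$ of $\mathcal{Ren}$, every type $A$ over $Fx$ and every $a:\mathsf{Var}_x(A)$, $$S_\alpha^{\mathsf{Tm}}(\mathsf{var}\,a)=\mathsf{var}^\bullet_{(x,\alpha_x),A}(\mathrm{id}_x,a).$$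 -/

import Mathlib

open CategoryTheory CategoryTheory.Limits Opposite

universe t h₁ h₂ h₃ o₁ o₂ o₃ u

namespace RelativeInduction

/-! ### Presheaves, their actions along functors, and local representability -/

section Presheaves

variable {C : Type o₁} [Category.{h₁} C] {D : Type o₂} [Category.{h₂} D]

/-- The restriction `x[σ]` of an element of a presheaf along a morphism. -/
def res (X : Cᵒᵖ ⥤ Type t) {Γ Δ : C} (σ : Δ ⟶ Γ) (x : X.obj (op Γ)) : X.obj (op Δ) :=
  X.map σ.op x

/-- The component at `Γ` of a map of presheaves over the same category. -/
def ap {X Y : Cᵒᵖ ⥤ Type t} (f : X ⟶ Y) {Γ : C} (x : X.obj (op Γ)) : Y.obj (op Γ) :=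
  f.app (op Γ) x

/-- The component at `Γ` of an action of a functor `F`, i.e. of a map `X ⟶ F^* X'`. -/
def act {F : C ⥤ D} {X : Cᵒᵖ ⥤ Type t} {X' : Dᵒᵖ ⥤ Type t} (f : X ⟶ F.op ⋙ X') {Γ : C}
    (x : X.obj (op Γ)) : X'.obj (op (F.obj Γ)) :=
  f.app (op Γ) x

theorem res_id (X : Cᵒᵖ ⥤ Type t) {Γ : C} (x : X.obj (op Γ)) : res X (𝟙 Γ) x = x := by
  simp [res]

theorem res_comp (X : Cᵒᵖ ⥤ Type t) {Γ Δ Θ : C} (τ : Θ ⟶ Δ) (σ : Δ ⟶ Γ) (x : X.obj (op Γ)) :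
    res X (τ ≫ σ) x = res X τ (res X σ x) := by
  simp [res]

theorem ap_res {X Y : Cᵒᵖ ⥤ Type t} (f : X ⟶ Y) {Γ Δ : C} (σ : Δ ⟶ Γ) (x : X.obj (op Γ)) :
    ap f (res X σ x) = res Y σ (ap f x) :=
  NatTrans.naturality_apply f σ.op x

theorem act_res {F : C ⥤ D} {X : Cᵒᵖ ⥤ Type t} {X' : Dᵒᵖ ⥤ Type t} (f : X ⟶ F.op ⋙ X')
    {Γ Δ : C} (σ : Δ ⟶ Γ) (x : X.obj (op Γ)) :
    act f (res X σ x) = res X' (F.map σ) (act f x) :=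
  NatTrans.naturality_apply f σ.op x

/-- A dependent presheaf over `X` is given by its total map `π : Y ⟶ X`. The object `E`, the
projection `p : E ⟶ Γ` and the generic element `q` form a context extension of `Γ` by the
restriction of this dependent presheaf to `x`: they represent the presheaf
`σ ↦ {y | π y = x[σ]}` on the slice over `Γ`. -/
structure IsExtension {X Y : Cᵒᵖ ⥤ Type t} (π : Y ⟶ X) {Γ : C} (x : X.obj (op Γ)) {E : C}
    (p : E ⟶ Γ) (q : Y.obj (op E)) : Prop where
  isOver : ap π q = res X p x
  existsUnique_lift : ∀ {Δ : C} (σ : Δ ⟶ Γ) (y : Y.obj (op Δ)), ap π y = res X σ x →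
    ∃! τ : Δ ⟶ E, τ ≫ p = σ ∧ res Y τ q = y

/-- Local representability of a dependent presheaf, given by its total map. -/
def IsLocallyRepresentable {X Y : Cᵒᵖ ⥤ Type t} (π : Y ⟶ X) : Prop :=
  ∀ (Γ : C) (x : X.obj (op Γ)), ∃ (E : C) (p : E ⟶ Γ) (q : Y.obj (op E)), IsExtension π x p q

/-- Preservation of context extensions (up to isomorphism) by an action of `F` on two dependent
presheaves: representations are sent to representations. -/
def PreservesExtensions (F : C ⥤ D) {X Y : Cᵒᵖ ⥤ Type t} (π : Y ⟶ X) {X' Y' : Dᵒᵖ ⥤ Type t}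
    (π' : Y' ⟶ X') (f : X ⟶ F.op ⋙ X') (g : Y ⟶ F.op ⋙ Y') : Prop :=
  ∀ ⦃Γ : C⦄ (x : X.obj (op Γ)) ⦃E : C⦄ (p : E ⟶ Γ) (q : Y.obj (op E)),
    IsExtension π x p q → IsExtension π' (act f x) (F.map p) (act g q)

/-- Preservation of terminal objects. -/
def PreservesTerminal (F : C ⥤ D) : Prop :=
  ∀ X : C, Nonempty (IsTerminal X) → Nonempty (IsTerminal (F.obj X))

end Presheaves

/-! ### Types, terms, and dependent families -/

/-- A presheaf of types together with a dependent presheaf of terms, given by its total map. -/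
structure TypeFamily (C : Type o₁) [Category.{h₁} C] where
  Ty : Cᵒᵖ ⥤ Type t
  Tm : Cᵒᵖ ⥤ Type t
  tp : Tm ⟶ Ty

namespace TypeFamily

variable {C : Type o₁} [Category.{h₁} C]

theorem tp_res (T : TypeFamily.{t} C) {Γ Δ Θ : C} {A : T.Ty.obj (op Γ)} (τ : Θ ⟶ Δ)
    {σ : Δ ⟶ Γ} {a : T.Tm.obj (op Δ)} (h : ap T.tp a = res T.Ty σ A) :
    ap T.tp (res T.Tm τ a) = res T.Ty (τ ≫ σ) A := by
  rw [ap_res, h, res_comp]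

theorem tp_id (T : TypeFamily.{t} C) {Γ : C} {A : T.Ty.obj (op Γ)} {a : T.Tm.obj (op Γ)}
    (h : ap T.tp a = A) : ap T.tp a = res T.Ty (𝟙 Γ) A := by
  rw [h, res_id]

theorem tp_restrict (T : TypeFamily.{t} C) {Γ Δ Θ : C} {A : T.Ty.obj (op Γ)} {σ : Δ ⟶ Γ}
    {A' : T.Ty.obj (op Δ)} (e : res T.Ty σ A = A') {τ : Θ ⟶ Δ} {a : T.Tm.obj (op Θ)}
    (h : ap T.tp a = res T.Ty τ A') : ap T.tp a = res T.Ty (τ ≫ σ) A := by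
  rw [h, ← e, res_comp]

end TypeFamily

/-- The elements at `Γ` of the presheaf exponential `Tm A → X`. For `X = Ty` these are the
families `B : Tm A → Ty`; the elements of `(a : Tm A) → Tm (B a)` are those `b : Tm A → Tm` with
`tp ∘ b = B`. -/
@[ext]
structure Fam {C : Type o₁} [Category.{h₁} C] (T : TypeFamily.{t} C) {Γ : C}
    (A : T.Ty.obj (op Γ)) (X : Cᵒᵖ ⥤ Type t) where
  val : ∀ {Δ : C} (σ : Δ ⟶ Γ) (a : T.Tm.obj (op Δ)), ap T.tp a = res T.Ty σ A → X.obj (op Δ)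
  val_res : ∀ {Δ Θ : C} (τ : Θ ⟶ Δ) (σ : Δ ⟶ Γ) (a : T.Tm.obj (op Δ))
    (h : ap T.tp a = res T.Ty σ A),
    res X τ (val σ a h) = val (τ ≫ σ) (res T.Tm τ a) (T.tp_res τ h)

namespace Fam

variable {C : Type o₁} [Category.{h₁} C] {T : TypeFamily.{t} C} {Γ : C} {A : T.Ty.obj (op Γ)}
  {X X' : Cᵒᵖ ⥤ Type t}

/-- Application of a family at its own stage. -/
def at' (B : Fam T A X) (a : T.Tm.obj (op Γ)) (h : ap T.tp a = A) : X.obj (op Γ) :=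
  B.val (𝟙 Γ) a (T.tp_id h)

/-- Restriction of a family; `A'` is `A[σ]`. -/
def restrict (B : Fam T A X) {Δ : C} (σ : Δ ⟶ Γ) {A' : T.Ty.obj (op Δ)}
    (e : res T.Ty σ A = A') : Fam T A' X where
  val τ a h := B.val (τ ≫ σ) a (T.tp_restrict e h)
  val_res τ σ' a h := by
    rw [B.val_res]
    congr 1
    simp

/-- Postcomposition of a family with a map of presheaves. -/
def map (B : Fam T A X) (f : X ⟶ X') : Fam T A X' where
  val σ a h := ap f (B.val σ a h)
  val_res τ σ a h := by rw [← ap_res, B.val_res]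

end Fam

/-- Actions of a functor `F` on types and terms. -/
structure FamilyMap {C : Type o₁} [Category.{h₁} C] {D : Type o₂} [Category.{h₂} D] (F : C ⥤ D)
    (T : TypeFamily.{t} C) (T' : TypeFamily.{t} D) where
  ty : T.Ty ⟶ F.op ⋙ T'.Ty
  tm : T.Tm ⟶ F.op ⋙ T'.Tm
  tp_tm : ∀ {Γ : C} (a : T.Tm.obj (op Γ)), ap T'.tp (act tm a) = act ty (ap T.tp a)

namespace FamilyMap

variable {C : Type o₁} [Category.{h₁} C] {D : Type o₂} [Category.{h₂} D] {F : C ⥤ D}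
  {T : TypeFamily.{t} C} {T' : TypeFamily.{t} D}

theorem tp_tm_eq (φ : FamilyMap F T T') {Γ Δ : C} {A : T.Ty.obj (op Γ)}
    {A' : T'.Ty.obj (op (F.obj Γ))} (hA : act φ.ty A = A') {σ : Δ ⟶ Γ} {a : T.Tm.obj (op Δ)}
    (h : ap T.tp a = res T.Ty σ A) : ap T'.tp (act φ.tm a) = res T'.Ty (F.map σ) A' := by
  rw [φ.tp_tm, h, act_res, hA]

/-- The family `B'` extends the image of the family `B` under the action of `F`:
`B' (F σ) (F a) = F (B σ a)`. If `F` preserves context extensions then every `B` has exactly one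
such `B'`, namely the image of `B` under the induced action of `F` on the sort of families. For
the projection of a displayed model the relation says that `B` lies over `B'`. -/
def Matches (φ : FamilyMap F T T') {Γ : C} {A : T.Ty.obj (op Γ)} {A' : T'.Ty.obj (op (F.obj Γ))}
    (hA : act φ.ty A = A') {X : Cᵒᵖ ⥤ Type t} {X' : Dᵒᵖ ⥤ Type t} (f : X ⟶ F.op ⋙ X')
    (B : Fam T A X) (B' : Fam T' A' X') : Prop :=
  ∀ ⦃Δ : C⦄ (σ : Δ ⟶ Γ) (a : T.Tm.obj (op Δ)) (h : ap T.tp a = res T.Ty σ A),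
    B'.val (F.map σ) (act φ.tm a) (φ.tp_tm_eq hA h) = act f (B.val σ a h)

theorem Matches.restrict {φ : FamilyMap F T T'} {Γ : C} {A : T.Ty.obj (op Γ)}
    {A' : T'.Ty.obj (op (F.obj Γ))} {hA : act φ.ty A = A'} {X : Cᵒᵖ ⥤ Type t}
    {X' : Dᵒᵖ ⥤ Type t} {f : X ⟶ F.op ⋙ X'} {B : Fam T A X} {B' : Fam T' A' X'}
    (hB : φ.Matches hA f B B') {Δ : C} (σ : Δ ⟶ Γ) {A₁ : T.Ty.obj (op Δ)}
    {A₁' : T'.Ty.obj (op (F.obj Δ))} (e : res T.Ty σ A = A₁)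
    (e' : res T'.Ty (F.map σ) A' = A₁') (hA₁ : act φ.ty A₁ = A₁') :
    φ.Matches hA₁ f (B.restrict σ e) (B'.restrict (F.map σ) e') := by
  intro Θ τ a h
  have := hB (τ ≫ σ) a (T.tp_restrict e h)
  simp only [Fam.restrict]
  rw [← this]
  congr 1
  simp

theorem Matches.mapTp {φ : FamilyMap F T T'} {Γ : C} {A : T.Ty.obj (op Γ)}
    {A' : T'.Ty.obj (op (F.obj Γ))} {hA : act φ.ty A = A'} {b : Fam T A T.Tm}
    {b' : Fam T' A' T'.Tm} (hb : φ.Matches hA φ.tm b b') :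
    φ.Matches hA φ.ty (b.map T.tp) (b'.map T'.tp) := by
  intro Δ σ a h
  simp only [Fam.map]
  rw [hb σ a h, φ.tp_tm]

end FamilyMap

/-! ### Models of the type theory with Π-types and booleans -/

/-- A model: a category with a terminal object and, in presheaves over it, a type family with
locally representable terms, Π-types and booleans. The isomorphism
`app : Tm (Π A B) ≃ ((a : Tm A) → Tm (B a))` is given by its inverse `lam`, which is natural and
bijective; application is `b ↦ b a` under this bijection. -/
structure Model (C : Type o₁) [Category.{h₁} C] extends TypeFamily.{t} C where
  hasTerminal : HasTerminal C
  rep : IsLocallyRepresentable tp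
  Pi : ∀ {Γ : C} (A : Ty.obj (op Γ)) (_ : Fam toTypeFamily A Ty), Ty.obj (op Γ)
  Pi_res : ∀ {Γ Δ : C} (σ : Δ ⟶ Γ) (A : Ty.obj (op Γ)) (B : Fam toTypeFamily A Ty),
    res Ty σ (Pi A B) = Pi (res Ty σ A) (B.restrict σ rfl)
  lam : ∀ {Γ : C} (A : Ty.obj (op Γ)) (_ : Fam toTypeFamily A Tm), Tm.obj (op Γ)
  lam_res : ∀ {Γ Δ : C} (σ : Δ ⟶ Γ) (A : Ty.obj (op Γ)) (b : Fam toTypeFamily A Tm),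
    res Tm σ (lam A b) = lam (res Ty σ A) (b.restrict σ rfl)
  tp_lam : ∀ {Γ : C} (A : Ty.obj (op Γ)) (b : Fam toTypeFamily A Tm),
    ap tp (lam A b) = Pi A (b.map tp)
  lam_bijective : ∀ {Γ : C} (A : Ty.obj (op Γ)) (B : Fam toTypeFamily A Ty)
    (f : Tm.obj (op Γ)), ap tp f = Pi A B →
    ∃! b : Fam toTypeFamily A Tm, b.map tp = B ∧ lam A b = f
  bool : ∀ Γ : C, Ty.obj (op Γ)
  bool_res : ∀ {Γ Δ : C} (σ : Δ ⟶ Γ), res Ty σ (bool Γ) = bool Δ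
  tt : ∀ Γ : C, Tm.obj (op Γ)
  tt_res : ∀ {Γ Δ : C} (σ : Δ ⟶ Γ), res Tm σ (tt Γ) = tt Δ
  tp_tt : ∀ Γ : C, ap tp (tt Γ) = bool Γ
  ff : ∀ Γ : C, Tm.obj (op Γ)
  ff_res : ∀ {Γ Δ : C} (σ : Δ ⟶ Γ), res Tm σ (ff Γ) = ff Δ
  tp_ff : ∀ Γ : C, ap tp (ff Γ) = bool Γ
  boolElim : ∀ {Γ : C} (P : Fam toTypeFamily (bool Γ) Ty) (t f b : Tm.obj (op Γ)),
    ap tp t = P.at' (tt Γ) (tp_tt Γ) → ap tp f = P.at' (ff Γ) (tp_ff Γ) → ap tp b = bool Γ →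
    Tm.obj (op Γ)
  tp_boolElim : ∀ {Γ : C} (P : Fam toTypeFamily (bool Γ) Ty) (t f b : Tm.obj (op Γ))
    (ht : ap tp t = P.at' (tt Γ) (tp_tt Γ)) (hf : ap tp f = P.at' (ff Γ) (tp_ff Γ))
    (hb : ap tp b = bool Γ), ap tp (boolElim P t f b ht hf hb) = P.at' b hb
  boolElim_res : ∀ {Γ Δ : C} (σ : Δ ⟶ Γ) (P : Fam toTypeFamily (bool Γ) Ty)
    (t f b : Tm.obj (op Γ))
    (ht : ap tp t = P.at' (tt Γ) (tp_tt Γ)) (hf : ap tp f = P.at' (ff Γ) (tp_ff Γ))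
    (hb : ap tp b = bool Γ) (ht' hf' hb'),
    res Tm σ (boolElim P t f b ht hf hb) =
      boolElim (P.restrict σ (bool_res σ)) (res Tm σ t) (res Tm σ f) (res Tm σ b) ht' hf' hb'
  boolElim_tt : ∀ {Γ : C} (P : Fam toTypeFamily (bool Γ) Ty) (t f : Tm.obj (op Γ))
    (ht : ap tp t = P.at' (tt Γ) (tp_tt Γ)) (hf : ap tp f = P.at' (ff Γ) (tp_ff Γ)),
    boolElim P t f (tt Γ) ht hf (tp_tt Γ) = t
  boolElim_ff : ∀ {Γ : C} (P : Fam toTypeFamily (bool Γ) Ty) (t f : Tm.obj (op Γ))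
    (ht : ap tp t = P.at' (tt Γ) (tp_tt Γ)) (hf : ap tp f = P.at' (ff Γ) (tp_ff Γ)),
    boolElim P t f (ff Γ) ht hf (tp_ff Γ) = f

/-- Morphisms of models: functors with actions on types and terms that preserve the terminal
object and context extensions up to isomorphism and the type-theoretic operations strictly.
(Preservation of `lam` is equivalent to preservation of its inverse `app`. The typing hypotheses
with a prime follow from those without.) -/
structure ModelHom {C : Type o₁} [Category.{h₁} C] {D : Type o₂} [Category.{h₂} D]
    (M : Model.{t} C) (N : Model.{t} D) where
  functor : C ⥤ D
  map : FamilyMap functor M.toTypeFamily N.toTypeFamily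
  terminal : PreservesTerminal functor
  ext : PreservesExtensions functor M.tp N.tp map.ty map.tm
  Pi : ∀ {Γ : C} (A : M.Ty.obj (op Γ)) (B : Fam M.toTypeFamily A M.Ty)
    (B' : Fam N.toTypeFamily (act map.ty A) N.Ty), map.Matches rfl map.ty B B' →
    act map.ty (M.Pi A B) = N.Pi (act map.ty A) B'
  lam : ∀ {Γ : C} (A : M.Ty.obj (op Γ)) (b : Fam M.toTypeFamily A M.Tm)
    (b' : Fam N.toTypeFamily (act map.ty A) N.Tm), map.Matches rfl map.tm b b' →
    act map.tm (M.lam A b) = N.lam (act map.ty A) b'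
  bool : ∀ Γ : C, act map.ty (M.bool Γ) = N.bool (functor.obj Γ)
  tt : ∀ Γ : C, act map.tm (M.tt Γ) = N.tt (functor.obj Γ)
  ff : ∀ Γ : C, act map.tm (M.ff Γ) = N.ff (functor.obj Γ)
  boolElim : ∀ {Γ : C} (P : Fam M.toTypeFamily (M.bool Γ) M.Ty)
    (P' : Fam N.toTypeFamily (N.bool (functor.obj Γ)) N.Ty),
    map.Matches (bool Γ) map.ty P P' → ∀ (t f b : M.Tm.obj (op Γ)) (ht hf hb ht' hf' hb'),
    act map.tm (M.boolElim P t f b ht hf hb) =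
      N.boolElim P' (act map.tm t) (act map.tm f) (act map.tm b) ht' hf' hb'

/-- 2-cells between morphisms of models: natural isomorphisms of the underlying functors that
are compatible with the actions on types and terms. -/
structure ModelHom.IsTwoCell {C : Type o₁} [Category.{h₁} C] {D : Type o₂} [Category.{h₂} D]
    {M : Model.{t} C} {N : Model.{t} D} (f g : ModelHom M N) (θ : f.functor ≅ g.functor) :
    Prop where
  ty : ∀ {Γ : C} (A : M.Ty.obj (op Γ)), act f.map.ty A = res N.Ty (θ.hom.app Γ) (act g.map.ty A)
  tm : ∀ {Γ : C} (a : M.Tm.obj (op Γ)), act f.map.tm a = res N.Tm (θ.hom.app Γ) (act g.map.tm a)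

/-- Biinitiality among the models of the indicated sizes: up to a unique 2-cell there is exactly
one morphism to every such model. -/
def Model.IsBiinitial.{o, h, t', o', h'} {C : Type o} [Category.{h} C] (M : Model.{t'} C) :
    Prop :=
  ∀ (D : Type o') [Category.{h'} D] (N : Model.{t'} D), Nonempty (ModelHom M N) ∧
    ∀ f g : ModelHom M N, ∃! θ : f.functor ≅ g.functor, ModelHom.IsTwoCell f g θ

/-! ### Displayed models -/

/-- A (global) displayed model without context extensions over a functor `F` into a model `M`.
The displayed types over `A` are the elements of `Ty` with base `A`, and the displayed terms over
`a` of displayed type `A'` are the elements of `Tm` with base `a` and type `A'`. In the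
operations, `B'`, `b'`, `P'` are displayed families over families `B`, `b`, `P` of `M`. -/
structure DispModel {C : Type o₁} [Category.{h₁} C] {S : Type o₂} [Category.{h₂} S] (F : C ⥤ S)
    (M : Model.{t} S) extends TypeFamily.{t} C where
  base : FamilyMap F toTypeFamily M.toTypeFamily
  Pi : ∀ {Γ : C} {A : M.Ty.obj (op (F.obj Γ))} (B : Fam M.toTypeFamily A M.Ty)
    (A' : Ty.obj (op Γ)) (hA : act base.ty A' = A) (B' : Fam toTypeFamily A' Ty),
    base.Matches hA base.ty B' B → Ty.obj (op Γ)
  base_Pi : ∀ {Γ : C} {A : M.Ty.obj (op (F.obj Γ))} (B : Fam M.toTypeFamily A M.Ty)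
    (A' : Ty.obj (op Γ)) (hA : act base.ty A' = A) (B' : Fam toTypeFamily A' Ty)
    (hB : base.Matches hA base.ty B' B), act base.ty (Pi B A' hA B' hB) = M.Pi A B
  Pi_res : ∀ {Γ Δ : C} (σ : Δ ⟶ Γ) {A : M.Ty.obj (op (F.obj Γ))} (B : Fam M.toTypeFamily A M.Ty)
    (A' : Ty.obj (op Γ)) (hA : act base.ty A' = A) (B' : Fam toTypeFamily A' Ty)
    (hB : base.Matches hA base.ty B' B)
    (hA' : act base.ty (res Ty σ A') = res M.Ty (F.map σ) A),
    res Ty σ (Pi B A' hA B' hB) =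
      Pi (B.restrict (F.map σ) rfl) (res Ty σ A') hA' (B'.restrict σ rfl)
        (hB.restrict σ rfl rfl hA')
  lam : ∀ {Γ : C} {A : M.Ty.obj (op (F.obj Γ))} (b : Fam M.toTypeFamily A M.Tm)
    (A' : Ty.obj (op Γ)) (hA : act base.ty A' = A) (b' : Fam toTypeFamily A' Tm),
    base.Matches hA base.tm b' b → Tm.obj (op Γ)
  base_lam : ∀ {Γ : C} {A : M.Ty.obj (op (F.obj Γ))} (b : Fam M.toTypeFamily A M.Tm)
    (A' : Ty.obj (op Γ)) (hA : act base.ty A' = A) (b' : Fam toTypeFamily A' Tm)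
    (hb : base.Matches hA base.tm b' b), act base.tm (lam b A' hA b' hb) = M.lam A b
  lam_res : ∀ {Γ Δ : C} (σ : Δ ⟶ Γ) {A : M.Ty.obj (op (F.obj Γ))}
    (b : Fam M.toTypeFamily A M.Tm)
    (A' : Ty.obj (op Γ)) (hA : act base.ty A' = A) (b' : Fam toTypeFamily A' Tm)
    (hb : base.Matches hA base.tm b' b)
    (hA' : act base.ty (res Ty σ A') = res M.Ty (F.map σ) A),
    res Tm σ (lam b A' hA b' hb) =
      lam (b.restrict (F.map σ) rfl) (res Ty σ A') hA' (b'.restrict σ rfl)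
        (hb.restrict σ rfl rfl hA')
  tp_lam : ∀ {Γ : C} {A : M.Ty.obj (op (F.obj Γ))} (b : Fam M.toTypeFamily A M.Tm)
    (A' : Ty.obj (op Γ)) (hA : act base.ty A' = A) (b' : Fam toTypeFamily A' Tm)
    (hb : base.Matches hA base.tm b' b),
    ap tp (lam b A' hA b' hb) = Pi (b.map M.tp) A' hA (b'.map tp) hb.mapTp
  /-- For a term `f = lam b` of `Π A B`, displayed terms of `Π A' B'` over `f` correspond
  bijectively to displayed families of terms of `B'` over `b`. -/
  lam_bijective : ∀ {Γ : C} {A : M.Ty.obj (op (F.obj Γ))} (B : Fam M.toTypeFamily A M.Ty)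
    (A' : Ty.obj (op Γ)) (hA : act base.ty A' = A) (B' : Fam toTypeFamily A' Ty)
    (hB : base.Matches hA base.ty B' B) (b : Fam M.toTypeFamily A M.Tm), b.map M.tp = B →
    ∀ f' : Tm.obj (op Γ), ap tp f' = Pi B A' hA B' hB → act base.tm f' = M.lam A b →
    ∃! b' : Fam toTypeFamily A' Tm, b'.map tp = B' ∧
      ∃ hb : base.Matches hA base.tm b' b, lam b A' hA b' hb = f'
  bool : ∀ Γ : C, Ty.obj (op Γ)
  bool_res : ∀ {Γ Δ : C} (σ : Δ ⟶ Γ), res Ty σ (bool Γ) = bool Δ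
  base_bool : ∀ Γ : C, act base.ty (bool Γ) = M.bool (F.obj Γ)
  tt : ∀ Γ : C, Tm.obj (op Γ)
  tt_res : ∀ {Γ Δ : C} (σ : Δ ⟶ Γ), res Tm σ (tt Γ) = tt Δ
  tp_tt : ∀ Γ : C, ap tp (tt Γ) = bool Γ
  base_tt : ∀ Γ : C, act base.tm (tt Γ) = M.tt (F.obj Γ)
  ff : ∀ Γ : C, Tm.obj (op Γ)
  ff_res : ∀ {Γ Δ : C} (σ : Δ ⟶ Γ), res Tm σ (ff Γ) = ff Δ
  tp_ff : ∀ Γ : C, ap tp (ff Γ) = bool Γ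
  base_ff : ∀ Γ : C, act base.tm (ff Γ) = M.ff (F.obj Γ)
  boolElim : ∀ {Γ : C} (P : Fam M.toTypeFamily (M.bool (F.obj Γ)) M.Ty)
    (P' : Fam toTypeFamily (bool Γ) Ty), base.Matches (base_bool Γ) base.ty P' P →
    ∀ t' f' b' : Tm.obj (op Γ), ap tp t' = P'.at' (tt Γ) (tp_tt Γ) →
    ap tp f' = P'.at' (ff Γ) (tp_ff Γ) → ap tp b' = bool Γ → Tm.obj (op Γ)
  base_boolElim : ∀ {Γ : C} (P : Fam M.toTypeFamily (M.bool (F.obj Γ)) M.Ty)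
    (P' : Fam toTypeFamily (bool Γ) Ty) (hP : base.Matches (base_bool Γ) base.ty P' P)
    (t' f' b' : Tm.obj (op Γ)) (ht hf hb ht' hf' hb'),
    act base.tm (boolElim P P' hP t' f' b' ht hf hb) =
      M.boolElim P (act base.tm t') (act base.tm f') (act base.tm b') ht' hf' hb'
  tp_boolElim : ∀ {Γ : C} (P : Fam M.toTypeFamily (M.bool (F.obj Γ)) M.Ty)
    (P' : Fam toTypeFamily (bool Γ) Ty) (hP : base.Matches (base_bool Γ) base.ty P' P)
    (t' f' b' : Tm.obj (op Γ)) (ht hf) (hb : ap tp b' = bool Γ),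
    ap tp (boolElim P P' hP t' f' b' ht hf hb) = P'.at' b' hb
  boolElim_res : ∀ {Γ Δ : C} (σ : Δ ⟶ Γ) (P : Fam M.toTypeFamily (M.bool (F.obj Γ)) M.Ty)
    (P' : Fam toTypeFamily (bool Γ) Ty) (hP : base.Matches (base_bool Γ) base.ty P' P)
    (t' f' b' : Tm.obj (op Γ)) (ht hf hb ht' hf' hb'),
    res Tm σ (boolElim P P' hP t' f' b' ht hf hb) =
      boolElim (P.restrict (F.map σ) (M.bool_res _)) (P'.restrict σ (bool_res σ))
        (hP.restrict σ _ _ (base_bool Δ)) (res Tm σ t') (res Tm σ f') (res Tm σ b') ht' hf' hb'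
  boolElim_tt : ∀ {Γ : C} (P : Fam M.toTypeFamily (M.bool (F.obj Γ)) M.Ty)
    (P' : Fam toTypeFamily (bool Γ) Ty) (hP : base.Matches (base_bool Γ) base.ty P' P)
    (t' f' : Tm.obj (op Γ)) (ht hf), boolElim P P' hP t' f' (tt Γ) ht hf (tp_tt Γ) = t'
  boolElim_ff : ∀ {Γ : C} (P : Fam M.toTypeFamily (M.bool (F.obj Γ)) M.Ty)
    (P' : Fam toTypeFamily (bool Γ) Ty) (hP : base.Matches (base_bool Γ) base.ty P' P)
    (t' f' : Tm.obj (op Γ)) (ht hf), boolElim P P' hP t' f' (ff Γ) ht hf (tp_ff Γ) = f'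

/-- A displayed model has context extensions if its total category has a terminal object,
preserved by the projection, and if for every displayed type `A'` over `A` the presheaf of pairs
`(a, a')` of a term of `A` and a displayed term of `A'` over it is locally representable, with
the first projection preserving context extensions. (These pairs are the elements of `Tm` of
type `A'`.) -/
structure DispModel.HasContextExtensions {C : Type o₁} [Category.{h₁} C] {S : Type o₂}
    [Category.{h₂} S] {F : C ⥤ S} {M : Model.{t} S} (D : DispModel F M) : Prop where
  hasTerminal : HasTerminal C
  terminal : PreservesTerminal F
  rep : IsLocallyRepresentable D.tp
  ext : PreservesExtensions F D.tp M.tp D.base.ty D.base.tm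

/-- A section of a displayed model `D` over `G : P ⥤ S`: a section of the functor `G` up to
natural isomorphism, with actions on types and terms that lie over the identity, preserve the
terminal object and context extensions, and preserve the type-theoretic operations. In `Pi`,
`lam` and `boolElim` the displayed family with a prime is the image of the given family. -/
structure DispSection {P : Type o₁} [Category.{h₁} P] {S : Type o₂} [Category.{h₂} S] {G : P ⥤ S}
    {M : Model.{t} S} (D : DispModel G M) where
  functor : S ⥤ P
  iso : functor ⋙ G ≅ 𝟭 S
  map : FamilyMap functor M.toTypeFamily D.toTypeFamily
  base_ty : ∀ {Γ : S} (A : M.Ty.obj (op Γ)),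
    act D.base.ty (act map.ty A) = res M.Ty (iso.hom.app Γ) A
  base_tm : ∀ {Γ : S} (a : M.Tm.obj (op Γ)),
    act D.base.tm (act map.tm a) = res M.Tm (iso.hom.app Γ) a
  terminal : PreservesTerminal functor
  ext : PreservesExtensions functor M.tp D.tp map.ty map.tm
  Pi : ∀ {Γ : S} (A : M.Ty.obj (op Γ)) (B : Fam M.toTypeFamily A M.Ty)
    (B' : Fam D.toTypeFamily (act map.ty A) D.Ty), map.Matches rfl map.ty B B' →
    ∀ hB, act map.ty (M.Pi A B) =
      D.Pi (B.restrict (iso.hom.app Γ) rfl) (act map.ty A) (base_ty A) B' hB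
  lam : ∀ {Γ : S} (A : M.Ty.obj (op Γ)) (b : Fam M.toTypeFamily A M.Tm)
    (b' : Fam D.toTypeFamily (act map.ty A) D.Tm), map.Matches rfl map.tm b b' →
    ∀ hb, act map.tm (M.lam A b) =
      D.lam (b.restrict (iso.hom.app Γ) rfl) (act map.ty A) (base_ty A) b' hb
  bool : ∀ Γ : S, act map.ty (M.bool Γ) = D.bool (functor.obj Γ)
  tt : ∀ Γ : S, act map.tm (M.tt Γ) = D.tt (functor.obj Γ)
  ff : ∀ Γ : S, act map.tm (M.ff Γ) = D.ff (functor.obj Γ)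
  boolElim : ∀ {Γ : S} (Q : Fam M.toTypeFamily (M.bool Γ) M.Ty)
    (Q' : Fam D.toTypeFamily (D.bool (functor.obj Γ)) D.Ty),
    map.Matches (bool Γ) map.ty Q Q' →
    ∀ (hQ) (t f b : M.Tm.obj (op Γ)) (ht hf hb ht' hf' hb'),
    act map.tm (M.boolElim Q t f b ht hf hb) =
      D.boolElim (Q.restrict (iso.hom.app Γ) (M.bool_res _)) Q' hQ
        (act map.tm t) (act map.tm f) (act map.tm b) ht' hf' hb'

/-! ### Factorizations, displayed inserters, relative sections -/

/-- A factorization `C ⥤ P ⥤ S` (by `Y` and `G`) of a displayed model without context extensions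
`D` over `F`: `Y` is fully faithful, `P` carries a displayed model `disp` with context extensions
over `G`, and `Y` has bijective actions on displayed types and terms, which lie over the
identity and preserve the displayed operations. In `Pi`, `lam` and `boolElim` a displayed family
over `Y Γ` (with two primes) is compared with the displayed family over `Γ` (with one prime) to
which it restricts along `Y`. (As `F ≅ Y ⋙ G` and as the actions commute with
the bases, bijectivity on the total sets is bijectivity over every type and every term.) -/
structure Factorization.{v} {C : Type v} [Category.{v} C] {S : Type v} [Category.{v} S]
    {F : C ⥤ S} {M : Model.{v} S} (D : DispModel F M) where
  P : Type (v + 1)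
  [cat : Category.{v} P]
  Y : C ⥤ P
  G : P ⥤ S
  fac : Y ⋙ G ≅ F
  full : Y.Full
  faithful : Y.Faithful
  disp : DispModel G M
  hasExt : disp.HasContextExtensions
  map : FamilyMap Y D.toTypeFamily disp.toTypeFamily
  base_ty : ∀ {Γ : C} (A : D.Ty.obj (op Γ)),
    act disp.base.ty (act map.ty A) = res M.Ty (fac.hom.app Γ) (act D.base.ty A)
  base_tm : ∀ {Γ : C} (a : D.Tm.obj (op Γ)),
    act disp.base.tm (act map.tm a) = res M.Tm (fac.hom.app Γ) (act D.base.tm a)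
  bij_ty : ∀ Γ : C, Function.Bijective (fun A : D.Ty.obj (op Γ) => act map.ty A)
  bij_tm : ∀ Γ : C, Function.Bijective (fun a : D.Tm.obj (op Γ) => act map.tm a)
  Pi : ∀ {Γ : C} {A : M.Ty.obj (op (F.obj Γ))} (B : Fam M.toTypeFamily A M.Ty)
    (A' : D.Ty.obj (op Γ)) (hA : act D.base.ty A' = A) (B' : Fam D.toTypeFamily A' D.Ty)
    (hB : D.base.Matches hA D.base.ty B' B)
    (B'' : Fam disp.toTypeFamily (act map.ty A') disp.Ty), map.Matches rfl map.ty B' B'' →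
    ∀ (hA'' : act disp.base.ty (act map.ty A') = res M.Ty (fac.hom.app Γ) A) (hB''),
    act map.ty (D.Pi B A' hA B' hB) =
      disp.Pi (B.restrict (fac.hom.app Γ) rfl) (act map.ty A') hA'' B'' hB''
  lam : ∀ {Γ : C} {A : M.Ty.obj (op (F.obj Γ))} (b : Fam M.toTypeFamily A M.Tm)
    (A' : D.Ty.obj (op Γ)) (hA : act D.base.ty A' = A) (b' : Fam D.toTypeFamily A' D.Tm)
    (hb : D.base.Matches hA D.base.tm b' b)
    (b'' : Fam disp.toTypeFamily (act map.ty A') disp.Tm), map.Matches rfl map.tm b' b'' →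
    ∀ (hA'' : act disp.base.ty (act map.ty A') = res M.Ty (fac.hom.app Γ) A) (hb''),
    act map.tm (D.lam b A' hA b' hb) =
      disp.lam (b.restrict (fac.hom.app Γ) rfl) (act map.ty A') hA'' b'' hb''
  bool : ∀ Γ : C, act map.ty (D.bool Γ) = disp.bool (Y.obj Γ)
  tt : ∀ Γ : C, act map.tm (D.tt Γ) = disp.tt (Y.obj Γ)
  ff : ∀ Γ : C, act map.tm (D.ff Γ) = disp.ff (Y.obj Γ)
  boolElim : ∀ {Γ : C} (Q : Fam M.toTypeFamily (M.bool (F.obj Γ)) M.Ty)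
    (Q' : Fam D.toTypeFamily (D.bool Γ) D.Ty) (hQ : D.base.Matches (D.base_bool Γ) D.base.ty Q' Q)
    (Q'' : Fam disp.toTypeFamily (disp.bool (Y.obj Γ)) disp.Ty),
    map.Matches (bool Γ) map.ty Q' Q'' →
    ∀ (hQ'') (t f b : D.Tm.obj (op Γ)) (ht hf hb ht' hf' hb'),
    act map.tm (D.boolElim Q Q' hQ t f b ht hf hb) =
      disp.boolElim (Q.restrict (fac.hom.app Γ) (M.bool_res _)) Q'' hQ''
        (act map.tm t) (act map.tm f) (act map.tm b) ht' hf' hb'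

attribute [instance] Factorization.cat

section Relative

variable {C : Type u} [Category.{u} C] {S : Type u} [Category.{u} S] {F : C ⥤ S}
  {M : Model.{u} S} {D : DispModel F M}

/-- Objects of the displayed inserter of `Y` and `F ⋙ S₀`: an object `pt` of `C` with a morphism
`ι : Y pt ⟶ S₀ (F pt)` over the identity of `F pt`. -/
structure Inserter (𝓕 : Factorization D) (S₀ : DispSection 𝓕.disp) where
  pt : C
  ι : 𝓕.Y.obj pt ⟶ S₀.functor.obj (F.obj pt)
  isOver : 𝓕.G.map ι ≫ S₀.iso.hom.app (F.obj pt) = 𝓕.fac.hom.app pt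

namespace Inserter

variable {𝓕 : Factorization D} {S₀ : DispSection 𝓕.disp}

/-- Morphisms of the displayed inserter: morphisms of `C` that commute with `ι`. -/
@[ext]
structure Hom (X X' : Inserter 𝓕 S₀) where
  hom : X.pt ⟶ X'.pt
  comm : 𝓕.Y.map hom ≫ X'.ι = X.ι ≫ S₀.functor.map (F.map hom)

instance : Category (Inserter 𝓕 S₀) where
  Hom := Hom
  id X := ⟨𝟙 X.pt, by simp⟩
  comp f g := ⟨f.hom ≫ g.hom, by
    simp only [Functor.map_comp, Category.assoc, g.comm]
    rw [← Category.assoc, f.comm, Category.assoc]⟩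
  id_comp f := Hom.ext (Category.id_comp f.hom)
  comp_id f := Hom.ext (Category.comp_id f.hom)
  assoc f g k := Hom.ext (Category.assoc f.hom g.hom k.hom)

variable (𝓕 S₀) in
/-- The projection `I` of the displayed inserter. -/
def proj : Inserter 𝓕 S₀ ⥤ C where
  obj X := X.pt
  map f := f.hom

/-- The action on types `S_ι`: the displayed type of `D` that `Y` sends to `(S₀ A)[ι]`. -/
noncomputable def sTy (X : Inserter 𝓕 S₀) (A : M.Ty.obj (op (F.obj X.pt))) :
    D.Ty.obj (op X.pt) :=
  (Equiv.ofBijective _ (𝓕.bij_ty X.pt)).symm (res 𝓕.disp.Ty X.ι (act S₀.map.ty A))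

/-- The action on terms `S_ι`: the displayed term of `D` that `Y` sends to `(S₀ a)[ι]`. -/
noncomputable def sTm (X : Inserter 𝓕 S₀) (a : M.Tm.obj (op (F.obj X.pt))) :
    D.Tm.obj (op X.pt) :=
  (Equiv.ofBijective _ (𝓕.bij_tm X.pt)).symm (res 𝓕.disp.Tm X.ι (act S₀.map.tm a))

end Inserter

/-- The second component of a relative section `(S₀, α)` of a factorization: a natural
transformation `α : Y ⟶ F ⋙ S₀` over the identity of `F`. -/
structure RelativeSection (𝓕 : Factorization D) (S₀ : DispSection 𝓕.disp) where
  α : 𝓕.Y ⟶ F ⋙ S₀.functor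
  isOver : ∀ x : C, 𝓕.G.map (α.app x) ≫ S₀.iso.hom.app (F.obj x) = 𝓕.fac.hom.app x

namespace RelativeSection

variable {𝓕 : Factorization D} {S₀ : DispSection 𝓕.disp}

/-- The section `⟨α⟩` of the projection of the displayed inserter that corresponds to `α`. -/
def toInserter (s : RelativeSection 𝓕 S₀) : C ⥤ Inserter 𝓕 S₀ where
  obj x := ⟨x, s.α.app x, s.isOver x⟩
  map f := ⟨f, s.α.naturality f⟩

/-- The action of a relative section on types. -/
noncomputable def onTy (s : RelativeSection 𝓕 S₀) {x : C} (A : M.Ty.obj (op (F.obj x))) :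
    D.Ty.obj (op x) :=
  (s.toInserter.obj x).sTy A

/-- The action of a relative section on terms. -/
noncomputable def onTm (s : RelativeSection 𝓕 S₀) {x : C} (a : M.Tm.obj (op (F.obj x))) :
    D.Tm.obj (op x) :=
  (s.toInserter.obj x).sTm a

end RelativeSection

end Relative

/-! ### Renaming algebras -/

/-- A renaming algebra over a model `M`. The dependent presheaf of variables is given by its
total map `vtp : Var ⟶ F^* Ty`. -/
structure RenamingAlgebra {S : Type o₂} [Category.{h₂} S] (M : Model.{t} S) (R : Type o₁)
    [Category.{h₁} R] where
  F : R ⥤ S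
  hasTerminal : HasTerminal R
  terminal : PreservesTerminal F
  Var : Rᵒᵖ ⥤ Type t
  vtp : Var ⟶ F.op ⋙ M.Ty
  rep : IsLocallyRepresentable vtp
  var : Var ⟶ F.op ⋙ M.Tm
  tp_var : ∀ {x : R} (a : Var.obj (op x)), ap M.tp (act var a) = act vtp a
  ext : PreservesExtensions F vtp M.tp (𝟙 (F.op ⋙ M.Ty)) var

/-- Morphisms of renaming algebras over `M`: functors over `S` (up to natural isomorphism) with
an action on variables, preserving the terminal object and context extensions. -/
structure RenamingHom {S : Type o₃} [Category.{h₃} S] {M : Model.{t} S} {R : Type o₁}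
    [Category.{h₁} R] {R' : Type o₂} [Category.{h₂} R'] (𝓡 : RenamingAlgebra M R)
    (𝓡' : RenamingAlgebra M R') where
  functor : R ⥤ R'
  iso : functor ⋙ 𝓡'.F ≅ 𝓡.F
  onVar : 𝓡.Var ⟶ functor.op ⋙ 𝓡'.Var
  vtp_onVar : ∀ {x : R} (a : 𝓡.Var.obj (op x)),
    act 𝓡'.vtp (act onVar a) = res M.Ty (iso.hom.app x) (act 𝓡.vtp a)
  var_onVar : ∀ {x : R} (a : 𝓡.Var.obj (op x)),
    act 𝓡'.var (act onVar a) = res M.Tm (iso.hom.app x) (act 𝓡.var a)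
  terminal : PreservesTerminal functor
  ext : PreservesExtensions functor 𝓡.vtp 𝓡'.vtp
    (Functor.whiskerRight (NatTrans.op iso.hom) M.Ty) onVar

/-- 2-cells between morphisms of renaming algebras: natural isomorphisms over `S` that are
compatible with the actions on variables. -/
structure RenamingHom.IsTwoCell {S : Type o₃} [Category.{h₃} S] {M : Model.{t} S} {R : Type o₁}
    [Category.{h₁} R] {R' : Type o₂} [Category.{h₂} R'] {𝓡 : RenamingAlgebra M R}
    {𝓡' : RenamingAlgebra M R'} (f g : RenamingHom 𝓡 𝓡') (θ : f.functor ≅ g.functor) : Prop where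
  isOver : ∀ x : R, 𝓡'.F.map (θ.hom.app x) ≫ g.iso.hom.app x = f.iso.hom.app x
  onVar : ∀ {x : R} (a : 𝓡.Var.obj (op x)),
    act f.onVar a = res 𝓡'.Var (θ.hom.app x) (act g.onVar a)

/-- Biinitiality among the renaming algebras over `M` of the same size. A category of renamings
over `M` is a biinitial renaming algebra over `M`. -/
def RenamingAlgebra.IsBiinitial {S : Type o₂} [Category.{h₂} S] {M : Model.{t} S} {R : Type o₁}
    [Category.{h₁} R] (𝓡 : RenamingAlgebra M R) : Prop :=
  ∀ (R' : Type o₁) [Category.{h₁} R'] (𝓡' : RenamingAlgebra M R'), Nonempty (RenamingHom 𝓡 𝓡') ∧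
    ∀ f g : RenamingHom 𝓡 𝓡', ∃! θ : f.functor ≅ g.functor, RenamingHom.IsTwoCell f g θ

/-- Displayed interpretations `var•` of the variables, internally to presheaves over the displayed
inserter. For an object `X` of the inserter and a type `A` over `F X.pt`, it gives a dependent
natural transformation, over the slice of `R` over `X.pt`, from the variables of type `A` to the
displayed terms of type `S_ι A` over their images under `var`; moreover it is natural in `X`. -/
structure VarInterpretation {S : Type u} [Category.{u} S] {M : Model.{u} S} {R : Type u}
    [Category.{u} R] (𝓡 : RenamingAlgebra M R) {D : DispModel 𝓡.F M} (𝓕 : Factorization D)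
    (S₀ : DispSection 𝓕.disp) where
  val : ∀ (X : Inserter 𝓕 S₀) (A : M.Ty.obj (op (𝓡.F.obj X.pt))) {y : R} (ρ : y ⟶ X.pt)
    (a : 𝓡.Var.obj (op y)), act 𝓡.vtp a = res M.Ty (𝓡.F.map ρ) A → D.Tm.obj (op y)
  tp_val : ∀ (X : Inserter 𝓕 S₀) (A : M.Ty.obj (op (𝓡.F.obj X.pt))) {y : R} (ρ : y ⟶ X.pt)
    (a : 𝓡.Var.obj (op y)) (h : act 𝓡.vtp a = res M.Ty (𝓡.F.map ρ) A),
    ap D.tp (val X A ρ a h) = res D.Ty ρ (X.sTy A)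
  base_val : ∀ (X : Inserter 𝓕 S₀) (A : M.Ty.obj (op (𝓡.F.obj X.pt))) {y : R} (ρ : y ⟶ X.pt)
    (a : 𝓡.Var.obj (op y)) (h : act 𝓡.vtp a = res M.Ty (𝓡.F.map ρ) A),
    act D.base.tm (val X A ρ a h) = act 𝓡.var a
  val_res : ∀ (X : Inserter 𝓕 S₀) (A : M.Ty.obj (op (𝓡.F.obj X.pt))) {y z : R} (τ : z ⟶ y)
    (ρ : y ⟶ X.pt) (a : 𝓡.Var.obj (op y)) (h : act 𝓡.vtp a = res M.Ty (𝓡.F.map ρ) A) (h'),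
    res D.Tm τ (val X A ρ a h) = val X A (τ ≫ ρ) (res 𝓡.Var τ a) h'
  val_map : ∀ {X X' : Inserter 𝓕 S₀} (θ : X ⟶ X') (A : M.Ty.obj (op (𝓡.F.obj X'.pt))) {y : R}
    (ρ : y ⟶ X.pt) (a : 𝓡.Var.obj (op y))
    (h : act 𝓡.vtp a = res M.Ty (𝓡.F.map ρ) (res M.Ty (𝓡.F.map θ.hom) A)) (h'),
    val X (res M.Ty (𝓡.F.map θ.hom) A) ρ a h = val X' A (ρ ≫ θ.hom) a h'

theorem RenamingAlgebra.vtp_id {S : Type o₂} [Category.{h₂} S] {M : Model.{t} S} {R : Type o₁}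
    [Category.{h₁} R] (𝓡 : RenamingAlgebra M R) {x : R} (a : 𝓡.Var.obj (op x)) :
    act 𝓡.vtp a = res M.Ty (𝓡.F.map (𝟙 x)) (act 𝓡.vtp a) := by
  rw [CategoryTheory.Functor.map_id, res_id]

end RelativeInduction

open RelativeInduction

/-!
Sections of a displayed model with context extensions are obtained by passing to its total model:
biinitiality gives a morphism of models into it, and the composite of this morphism with the
projection is isomorphic to the identity, so that the morphism is a section.

Factorizations come from Artin glueing along the nerve of `F`. An object of the glueing category is
an object `Γ` of the base with a presheaf over `C` lying over `c ↦ (F c ⟶ Γ)`; a glued type over it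
is a type over `Γ` with compatible displayed types over the elements of the presheaf. Over the
representable objects the Yoneda lemma identifies the glued types and terms with the displayed ones.

A relative section is a section of the projection of the displayed inserter. The variables that the
section `S₀` sends to their given interpretations make the inserter into a renaming algebra: a
context of the inserter is extended by taking the interpretation of the new variable as the last
component of `ι`. Biinitiality of the renaming algebra then provides the section of the projection,
and every variable agrees with its interpretation because only such variables are available.
-/

namespace RelativeInduction

/-! ### Context extensions -/

section Extensions

variable {C : Type o₁} [Category.{h₁} C] {D : Type o₂} [Category.{h₂} D]

namespace IsExtension

variable {X Y : Cᵒᵖ ⥤ Type t} {π : Y ⟶ X} {Γ : C} {x : X.obj (op Γ)} {E : C} {p : E ⟶ Γ}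
  {q : Y.obj (op E)}

/-- The morphism `⟨σ, y⟩` into a context extension with components `σ` and `y`. -/
noncomputable def lift (hE : IsExtension π x p q) {Δ : C} (σ : Δ ⟶ Γ) (y : Y.obj (op Δ))
    (h : ap π y = res X σ x) : Δ ⟶ E :=
  (hE.existsUnique_lift σ y h).choose

theorem lift_p (hE : IsExtension π x p q) {Δ : C} (σ : Δ ⟶ Γ) (y : Y.obj (op Δ))
    (h : ap π y = res X σ x) : hE.lift σ y h ≫ p = σ :=
  (hE.existsUnique_lift σ y h).choose_spec.1.1

theorem res_lift_q (hE : IsExtension π x p q) {Δ : C} (σ : Δ ⟶ Γ) (y : Y.obj (op Δ))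
    (h : ap π y = res X σ x) : res Y (hE.lift σ y h) q = y :=
  (hE.existsUnique_lift σ y h).choose_spec.1.2

theorem isOver_comp (hE : IsExtension π x p q) {Δ : C} (τ : Δ ⟶ E) :
    ap π (res Y τ q) = res X (τ ≫ p) x := by
  rw [ap_res, hE.isOver, res_comp]

theorem hom_ext (hE : IsExtension π x p q) {Δ : C} {τ τ' : Δ ⟶ E} (hp : τ ≫ p = τ' ≫ p)
    (hq : res Y τ q = res Y τ' q) : τ = τ' :=
  (hE.existsUnique_lift (τ' ≫ p) (res Y τ' q) (hE.isOver_comp τ')).unique ⟨hp, hq⟩ ⟨rfl, rfl⟩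

theorem comp_lift (hE : IsExtension π x p q) {Δ Θ : C} (τ : Θ ⟶ Δ) (σ : Δ ⟶ Γ)
    (y : Y.obj (op Δ)) (h : ap π y = res X σ x) :
    τ ≫ hE.lift σ y h = hE.lift (τ ≫ σ) (res Y τ y) (by rw [ap_res, h, res_comp]) :=
  hE.hom_ext (by simp only [Category.assoc, lift_p]) (by simp only [res_comp, res_lift_q])

theorem lift_comp_lift (hE : IsExtension π x p q) {E' : C} {p' : E' ⟶ Γ} {q' : Y.obj (op E')}
    (hE' : IsExtension π x p' q') : hE.lift p' q' hE'.isOver ≫ hE'.lift p q hE.isOver = 𝟙 E' :=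
  hE'.hom_ext (by simp only [Category.assoc, lift_p, Category.id_comp])
    (by simp only [res_comp, res_lift_q, res_id])

/-- The comparison isomorphism between two context extensions by the same element. -/
noncomputable def uniqueUpToIso (hE : IsExtension π x p q) {E' : C} {p' : E' ⟶ Γ}
    {q' : Y.obj (op E')} (hE' : IsExtension π x p' q') : E' ≅ E where
  hom := hE.lift p' q' hE'.isOver
  inv := hE'.lift p q hE.isOver
  hom_inv_id := hE.lift_comp_lift hE'
  inv_hom_id := hE'.lift_comp_lift hE

theorem of_iso (hE : IsExtension π x p q) {E' : C} (e : E' ≅ E) :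
    IsExtension π x (e.hom ≫ p) (res Y e.hom q) where
  isOver := hE.isOver_comp e.hom
  existsUnique_lift σ y h := by
    refine ⟨hE.lift σ y h ≫ e.inv, ⟨?_, ?_⟩, ?_⟩
    · simp [hE.lift_p]
    · rw [← res_comp, Category.assoc, e.inv_hom_id, Category.comp_id, hE.res_lift_q]
    · rintro τ ⟨hp, hq⟩
      rw [Iso.eq_comp_inv]
      exact hE.hom_ext (by rw [Category.assoc, hp, hE.lift_p]) (by rw [res_comp, hq, hE.res_lift_q])

theorem congr (hE : IsExtension π x p q) {x' : X.obj (op Γ)} (hx : x = x') :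
    IsExtension π x' p q :=
  hx ▸ hE

theorem map_lift {F : C ⥤ D} {X' Y' : Dᵒᵖ ⥤ Type t} {π' : Y' ⟶ X'} {x' : X'.obj (op (F.obj Γ))}
    (hE : IsExtension π x p q) {g : Y ⟶ F.op ⋙ Y'} (hE' : IsExtension π' x' (F.map p) (act g q))
    {Δ : C} (σ : Δ ⟶ Γ) (y : Y.obj (op Δ)) (h : ap π y = res X σ x)
    (h' : ap π' (act g y) = res X' (F.map σ) x') :
    F.map (hE.lift σ y h) = hE'.lift (F.map σ) (act g y) h' :=
  hE'.hom_ext (by rw [lift_p, ← F.map_comp, lift_p]) (by rw [res_lift_q, ← act_res, res_lift_q])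

end IsExtension

theorem PreservesExtensions.of_exists {F : C ⥤ D} {X Y : Cᵒᵖ ⥤ Type t} {π : Y ⟶ X}
    {X' Y' : Dᵒᵖ ⥤ Type t} {π' : Y' ⟶ X'} {f : X ⟶ F.op ⋙ X'} {g : Y ⟶ F.op ⋙ Y'}
    (H : ∀ (Γ : C) (x : X.obj (op Γ)), ∃ (E : C) (p : E ⟶ Γ) (q : Y.obj (op E)),
      IsExtension π x p q ∧ IsExtension π' (act f x) (F.map p) (act g q)) :
    PreservesExtensions F π π' f g := by
  intro Γ x E' p' q' hE'
  obtain ⟨E, p, q, hE, hFE⟩ := H Γ x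
  have hFE' := hFE.of_iso (F.mapIso (hE.uniqueUpToIso hE'))
  simp only [Functor.mapIso_hom, IsExtension.uniqueUpToIso] at hFE'
  rwa [← F.map_comp, hE.lift_p, ← act_res, hE.res_lift_q] at hFE'

theorem PreservesTerminal.of_isTerminal {F : C ⥤ D} {X : C} (hX : IsTerminal X)
    (hFX : IsTerminal (F.obj X)) : PreservesTerminal F := fun _ ⟨hX'⟩ =>
  ⟨hFX.ofIso (F.mapIso (hX.uniqueUpToIso hX'))⟩

end Extensions

/-! ### Families and their images -/

namespace Fam

variable {C : Type o₁} [Category.{h₁} C] {T : TypeFamily.{t} C} {Γ : C} {A : T.Ty.obj (op Γ)}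
  {X : Cᵒᵖ ⥤ Type t}

theorem val_congr (B : Fam T A X) {Δ : C} {σ σ' : Δ ⟶ Γ} {a a' : T.Tm.obj (op Δ)}
    (h : ap T.tp a = res T.Ty σ A) (hσ : σ = σ') (ha : a = a') :
    B.val σ a h = B.val σ' a' (by rw [← hσ, ← ha, h]) := by
  subst hσ ha
  rfl

theorem ext_val {B B' : Fam T A X}
    (H : ∀ (Δ : C) (σ : Δ ⟶ Γ) (a : T.Tm.obj (op Δ)) (h : ap T.tp a = res T.Ty σ A),
      B.val σ a h = B'.val σ a h) : B = B' :=
  Fam.ext (by funext Δ σ a h; exact H Δ σ a h)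

theorem at'_restrict (B : Fam T A X) {Δ : C} (σ : Δ ⟶ Γ) {A' : T.Ty.obj (op Δ)}
    (e : res T.Ty σ A = A') (a : T.Tm.obj (op Δ)) (h : ap T.tp a = A') :
    (B.restrict σ e).at' a h = B.val σ a (h.trans e.symm) :=
  B.val_congr _ (Category.id_comp σ) rfl

theorem restrict_id (B : Fam T A X) (e : res T.Ty (𝟙 Γ) A = A) : B.restrict (𝟙 Γ) e = B :=
  ext_val fun _ _ _ _ => B.val_congr _ (Category.comp_id _) rfl

theorem restrict_restrict (B : Fam T A X) {Δ Θ : C} (σ : Δ ⟶ Γ) {A' : T.Ty.obj (op Δ)}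
    (e : res T.Ty σ A = A') (τ : Θ ⟶ Δ) {A'' : T.Ty.obj (op Θ)} (e' : res T.Ty τ A' = A'') :
    (B.restrict σ e).restrict τ e' = B.restrict (τ ≫ σ) (by rw [res_comp, e, e']) :=
  ext_val fun _ _ _ _ => B.val_congr _ (Category.assoc _ _ _) rfl

theorem res_at' (B : Fam T A X) (a : T.Tm.obj (op Γ)) (h : ap T.tp a = A) {Δ : C} (σ : Δ ⟶ Γ) :
    res X σ (B.at' a h) = B.val σ (res T.Tm σ a) (by rw [ap_res, h]) :=
  (B.val_res σ (𝟙 Γ) a _).trans (B.val_congr _ (Category.comp_id _) rfl)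

theorem tp_res_eq_at' {B : Fam T A T.Ty} {s a : T.Tm.obj (op Γ)} {ha : ap T.tp a = A}
    (hs : ap T.tp s = B.at' a ha) {Δ : C} (σ : Δ ⟶ Γ) {A' : T.Ty.obj (op Δ)}
    (e : res T.Ty σ A = A') {a' : T.Tm.obj (op Δ)} (ea : res T.Tm σ a = a')
    (ha' : ap T.tp a' = A') : ap T.tp (res T.Tm σ s) = (B.restrict σ e).at' a' ha' := by
  subst ea
  rw [ap_res, hs, res_at', at'_restrict]

section Generic

variable {E : C} {p : E ⟶ Γ} {q : T.Tm.obj (op E)}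

theorem val_eq_res_generic (hE : IsExtension T.tp A p q) (B : Fam T A X) {Δ : C} (σ : Δ ⟶ Γ)
    (a : T.Tm.obj (op Δ)) (h : ap T.tp a = res T.Ty σ A) :
    B.val σ a h = res X (hE.lift σ a h) (B.val p q hE.isOver) := by
  rw [B.val_res]
  exact B.val_congr _ (hE.lift_p σ a h).symm (hE.res_lift_q σ a h).symm

/-- The family over `A` whose value at the generic term of the context extension by `A` is `x`. -/
noncomputable def ofGeneric (hE : IsExtension T.tp A p q) (x : X.obj (op E)) : Fam T A X where
  val σ a h := res X (hE.lift σ a h) x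
  val_res τ σ a h := by rw [← res_comp, hE.comp_lift]

theorem ext_generic (hE : IsExtension T.tp A p q) {B B' : Fam T A X}
    (h : B.val p q hE.isOver = B'.val p q hE.isOver) : B = B' :=
  ext_val fun _ σ a ha => by rw [B.val_eq_res_generic hE, B'.val_eq_res_generic hE, h]

end Generic

end Fam

namespace FamilyMap

variable {C : Type o₁} [Category.{h₁} C] {D : Type o₂} [Category.{h₂} D] {F : C ⥤ D}
  {T : TypeFamily.{t} C} {T' : TypeFamily.{t} D} {φ : FamilyMap F T T'} {Γ : C}
  {A : T.Ty.obj (op Γ)} {A' : T'.Ty.obj (op (F.obj Γ))} {X : Cᵒᵖ ⥤ Type t} {X' : Dᵒᵖ ⥤ Type t}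
  {f : X ⟶ F.op ⋙ X'}

theorem matches_ofGeneric {E : C} {p : E ⟶ Γ} {q : T.Tm.obj (op E)} (hE : IsExtension T.tp A p q)
    (hA : act φ.ty A = A') (hE' : IsExtension T'.tp A' (F.map p) (act φ.tm q)) (B : Fam T A X) :
    φ.Matches hA f B (Fam.ofGeneric hE' (act f (B.val p q hE.isOver))) := by
  intro Δ σ a h
  calc res X' (hE'.lift (F.map σ) (act φ.tm a) _) (act f (B.val p q hE.isOver))
      = res X' (F.map (hE.lift σ a h)) (act f (B.val p q hE.isOver)) := by rw [hE.map_lift hE']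
    _ = act f (B.val σ a h) := by rw [← act_res, ← B.val_eq_res_generic hE]

theorem existsUnique_matches (hT : IsLocallyRepresentable T.tp)
    (hφ : PreservesExtensions F T.tp T'.tp φ.ty φ.tm) (hA : act φ.ty A = A')
    (f : X ⟶ F.op ⋙ X') (B : Fam T A X) : ∃! B' : Fam T' A' X', φ.Matches hA f B B' := by
  obtain ⟨E, p, q, hE⟩ := hT Γ A
  have hE' : IsExtension T'.tp A' (F.map p) (act φ.tm q) := (hφ A p q hE).congr hA
  have hB := matches_ofGeneric (f := f) hE hA hE' B
  exact ⟨_, hB, fun B' hB' =>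
    Fam.ext_generic hE' ((hB' p q hE.isOver).trans (hB p q hE.isOver).symm)⟩

theorem Matches.at' {hA : act φ.ty A = A'} {B : Fam T A X} {B' : Fam T' A' X'}
    (hB : φ.Matches hA f B B') (a : T.Tm.obj (op Γ)) (h : ap T.tp a = A)
    (h' : ap T'.tp (act φ.tm a) = A') : B'.at' (act φ.tm a) h' = act f (B.at' a h) :=
  (B'.val_congr _ (F.map_id Γ).symm rfl).trans (hB (𝟙 Γ) a (T.tp_id h))

theorem Matches.tp_eq_at' {hA : act φ.ty A = A'} {B : Fam T A T.Ty} {B' : Fam T' A' T'.Ty}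
    (hB : φ.Matches hA φ.ty B B') {s a : T.Tm.obj (op Γ)} {ha : ap T.tp a = A}
    (hs : ap T.tp s = B.at' a ha) {a' : T'.Tm.obj (op (F.obj Γ))} (e : act φ.tm a = a')
    (h' : ap T'.tp a' = A') : ap T'.tp (act φ.tm s) = B'.at' a' h' := by
  subst e
  rw [φ.tp_tm, hs, hB.at' a ha h']

end FamilyMap

/-! ### Composition of morphisms of models -/

section Comp

variable {C₁ : Type o₁} [Category.{h₁} C₁] {C₂ : Type o₂} [Category.{h₂} C₂] {C₃ : Type o₃}
  [Category.{h₃} C₃]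

theorem PreservesTerminal.comp {F : C₁ ⥤ C₂} {F' : C₂ ⥤ C₃} (hF : PreservesTerminal F)
    (hF' : PreservesTerminal F') : PreservesTerminal (F ⋙ F') :=
  fun X hX => hF' _ (hF X hX)

theorem PreservesExtensions.comp {F : C₁ ⥤ C₂} {F' : C₂ ⥤ C₃} {X₁ Y₁ : C₁ᵒᵖ ⥤ Type t}
    {X₂ Y₂ : C₂ᵒᵖ ⥤ Type t} {X₃ Y₃ : C₃ᵒᵖ ⥤ Type t} {π₁ : Y₁ ⟶ X₁} {π₂ : Y₂ ⟶ X₂} {π₃ : Y₃ ⟶ X₃}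
    {f : X₁ ⟶ F.op ⋙ X₂} {g : Y₁ ⟶ F.op ⋙ Y₂} {f' : X₂ ⟶ F'.op ⋙ X₃} {g' : Y₂ ⟶ F'.op ⋙ Y₃}
    (hF : PreservesExtensions F π₁ π₂ f g) (hF' : PreservesExtensions F' π₂ π₃ f' g') :
    PreservesExtensions (F ⋙ F') π₁ π₃ (f ≫ F.op.whiskerLeft f') (g ≫ F.op.whiskerLeft g') :=
  fun _ x _ p q hE => hF' _ _ _ (hF x p q hE)

namespace FamilyMap

variable {F : C₁ ⥤ C₂} {F' : C₂ ⥤ C₃} {T₁ : TypeFamily.{t} C₁} {T₂ : TypeFamily.{t} C₂}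
  {T₃ : TypeFamily.{t} C₃} {φ : FamilyMap F T₁ T₂} {ψ : FamilyMap F' T₂ T₃}

/-- The composite of two actions on types and terms. -/
def comp (φ : FamilyMap F T₁ T₂) (ψ : FamilyMap F' T₂ T₃) : FamilyMap (F ⋙ F') T₁ T₃ where
  ty := φ.ty ≫ F.op.whiskerLeft ψ.ty
  tm := φ.tm ≫ F.op.whiskerLeft ψ.tm
  tp_tm a := (ψ.tp_tm (act φ.tm a)).trans (congrArg (act ψ.ty) (φ.tp_tm a))

variable {Γ : C₁} {A₁ : T₁.Ty.obj (op Γ)} {A₂ : T₂.Ty.obj (op (F.obj Γ))}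
  {A₃ : T₃.Ty.obj (op (F'.obj (F.obj Γ)))} {X₁ : C₁ᵒᵖ ⥤ Type t} {X₂ : C₂ᵒᵖ ⥤ Type t}
  {X₃ : C₃ᵒᵖ ⥤ Type t} {f : X₁ ⟶ F.op ⋙ X₂} {f' : X₂ ⟶ F'.op ⋙ X₃}

theorem Matches.comp {hA : act φ.ty A₁ = A₂} {hA' : act ψ.ty A₂ = A₃} {B₁ : Fam T₁ A₁ X₁}
    {B₂ : Fam T₂ A₂ X₂} {B₃ : Fam T₃ A₃ X₃} (h : φ.Matches hA f B₁ B₂)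
    (h' : ψ.Matches hA' f' B₂ B₃) :
    (φ.comp ψ).Matches ((congrArg (act ψ.ty) hA).trans hA') (f ≫ F.op.whiskerLeft f') B₁ B₃ :=
  fun _ σ a ha => (h' _ _ _).trans (congrArg (act f') (h σ a ha))

theorem Matches.exists_of_comp (hT₁ : IsLocallyRepresentable T₁.tp)
    (hT₂ : IsLocallyRepresentable T₂.tp) (hφ : PreservesExtensions F T₁.tp T₂.tp φ.ty φ.tm)
    (hψ : PreservesExtensions F' T₂.tp T₃.tp ψ.ty ψ.tm) (hA : act φ.ty A₁ = A₂)
    (hA' : act ψ.ty A₂ = A₃) {B₁ : Fam T₁ A₁ X₁} {B₃ : Fam T₃ A₃ X₃}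
    (h : (φ.comp ψ).Matches ((congrArg (act ψ.ty) hA).trans hA') (f ≫ F.op.whiskerLeft f') B₁ B₃) :
    ∃ B₂ : Fam T₂ A₂ X₂, φ.Matches hA f B₁ B₂ ∧ ψ.Matches hA' f' B₂ B₃ := by
  obtain ⟨B₂, hB₂, -⟩ := existsUnique_matches hT₁ hφ hA f B₁
  obtain ⟨B₃', hB₃', -⟩ := existsUnique_matches hT₂ hψ hA' f' B₂
  obtain rfl : B₃ = B₃' :=
    (existsUnique_matches (φ := φ.comp ψ) hT₁ (hφ.comp hψ) _ _ B₁).unique h (hB₂.comp hB₃')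
  exact ⟨B₂, hB₂, hB₃'⟩

end FamilyMap

/-- The composite of two morphisms of models. -/
def ModelHom.comp {M₁ : Model.{t} C₁} {M₂ : Model.{t} C₂} {M₃ : Model.{t} C₃} (f : ModelHom M₁ M₂)
    (g : ModelHom M₂ M₃) : ModelHom M₁ M₃ where
  functor := f.functor ⋙ g.functor
  map := f.map.comp g.map
  terminal := f.terminal.comp g.terminal
  ext := f.ext.comp g.ext
  Pi A B B₃ h := by
    obtain ⟨B₂, hf, hg⟩ := h.exists_of_comp M₁.rep M₂.rep f.ext g.ext rfl rfl
    exact (congrArg (act g.map.ty) (f.Pi A B B₂ hf)).trans (g.Pi _ B₂ B₃ hg)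
  lam A b b₃ h := by
    obtain ⟨b₂, hf, hg⟩ := h.exists_of_comp M₁.rep M₂.rep f.ext g.ext rfl rfl
    exact (congrArg (act g.map.tm) (f.lam A b b₂ hf)).trans (g.lam _ b₂ b₃ hg)
  bool Γ := (congrArg (act g.map.ty) (f.bool Γ)).trans (g.bool _)
  tt Γ := (congrArg (act g.map.tm) (f.tt Γ)).trans (g.tt _)
  ff Γ := (congrArg (act g.map.tm) (f.ff Γ)).trans (g.ff _)
  boolElim {Γ} P P₃ h t e b ht he hb ht' he' hb' := by
    obtain ⟨P₂, hf, hg⟩ := h.exists_of_comp M₁.rep M₂.rep f.ext g.ext (f.bool Γ) (g.bool _)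
    exact (congrArg (act g.map.tm) (f.boolElim P P₂ hf t e b ht he hb
      (hf.tp_eq_at' ht (f.tt Γ) _) (hf.tp_eq_at' he (f.ff Γ) _)
      (by rw [f.map.tp_tm, hb, f.bool]))).trans (g.boolElim P₂ P₃ hg _ _ _ _ _ _ ht' he' hb')

end Comp

/-! ### The total model of a displayed model with context extensions -/

namespace DispModel

variable {P : Type o₁} [Category.{h₁} P] {S : Type o₂} [Category.{h₂} S] {G : P ⥤ S}
  {M : Model.{t} S} {D : DispModel G M}

namespace HasContextExtensions

variable (hD : D.HasContextExtensions)

section Base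

variable {Γ : P} {A' : D.Ty.obj (op Γ)} {A : M.Ty.obj (op (G.obj Γ))} {X' : Pᵒᵖ ⥤ Type t}
  {X : Sᵒᵖ ⥤ Type t}

/-- The family of the base model over which a family of the displayed model lies. -/
noncomputable def baseFam (hA : act D.base.ty A' = A) (f : X' ⟶ G.op ⋙ X)
    (B' : Fam D.toTypeFamily A' X') : Fam M.toTypeFamily A X :=
  (FamilyMap.existsUnique_matches hD.rep hD.ext hA f B').choose

theorem matches_baseFam (hA : act D.base.ty A' = A) (f : X' ⟶ G.op ⋙ X)
    (B' : Fam D.toTypeFamily A' X') : D.base.Matches hA f B' (hD.baseFam hA f B') :=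
  (FamilyMap.existsUnique_matches hD.rep hD.ext hA f B').choose_spec.1

theorem matches_unique (hD : D.HasContextExtensions) {hA : act D.base.ty A' = A}
    {f : X' ⟶ G.op ⋙ X} {B' : Fam D.toTypeFamily A' X'} {B B₁ : Fam M.toTypeFamily A X}
    (hB : D.base.Matches hA f B' B) (hB₁ : D.base.Matches hA f B' B₁) : B = B₁ :=
  (FamilyMap.existsUnique_matches hD.rep hD.ext hA f B').unique hB hB₁

theorem baseFam_eq {hA : act D.base.ty A' = A} {f : X' ⟶ G.op ⋙ X}
    {B' : Fam D.toTypeFamily A' X'} {B : Fam M.toTypeFamily A X}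
    (hB : D.base.Matches hA f B' B) : hD.baseFam hA f B' = B :=
  hD.matches_unique (hD.matches_baseFam hA f B') hB

end Base

/-- The Π-types of the total model. -/
noncomputable def totalPi {Γ : P} (A' : D.Ty.obj (op Γ)) (B' : Fam D.toTypeFamily A' D.Ty) :
    D.Ty.obj (op Γ) :=
  D.Pi (hD.baseFam rfl D.base.ty B') A' rfl B' (hD.matches_baseFam rfl D.base.ty B')

theorem totalPi_eq {Γ : P} {A : M.Ty.obj (op (G.obj Γ))} (B : Fam M.toTypeFamily A M.Ty)
    (A' : D.Ty.obj (op Γ)) (hA : act D.base.ty A' = A) (B' : Fam D.toTypeFamily A' D.Ty)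
    (hB : D.base.Matches hA D.base.ty B' B) : hD.totalPi A' B' = D.Pi B A' hA B' hB := by
  subst hA
  obtain rfl := hD.baseFam_eq hB
  rfl

/-- The abstractions of the total model. -/
noncomputable def totalLam {Γ : P} (A' : D.Ty.obj (op Γ)) (b' : Fam D.toTypeFamily A' D.Tm) :
    D.Tm.obj (op Γ) :=
  D.lam (hD.baseFam rfl D.base.tm b') A' rfl b' (hD.matches_baseFam rfl D.base.tm b')

theorem totalLam_eq {Γ : P} {A : M.Ty.obj (op (G.obj Γ))} (b : Fam M.toTypeFamily A M.Tm)
    (A' : D.Ty.obj (op Γ)) (hA : act D.base.ty A' = A) (b' : Fam D.toTypeFamily A' D.Tm)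
    (hb : D.base.Matches hA D.base.tm b' b) : hD.totalLam A' b' = D.lam b A' hA b' hb := by
  subst hA
  obtain rfl := hD.baseFam_eq hb
  rfl

theorem existsUnique_totalLam {Γ : P} (A' : D.Ty.obj (op Γ)) (B' : Fam D.toTypeFamily A' D.Ty)
    (f' : D.Tm.obj (op Γ)) (hf' : ap D.tp f' = hD.totalPi A' B') :
    ∃! b' : Fam D.toTypeFamily A' D.Tm, b'.map D.tp = B' ∧ hD.totalLam A' b' = f' := by
  have hB' := hD.matches_baseFam rfl D.base.ty B'
  obtain ⟨b, ⟨hb_tp, hb_lam⟩, hb_unique⟩ := M.lam_bijective (act D.base.ty A') _ (act D.base.tm f')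
    (by rw [D.base.tp_tm, hf', totalPi, D.base_Pi])
  obtain ⟨b', ⟨hb'_tp, hb', hb'_lam⟩, hb'_unique⟩ :=
    D.lam_bijective _ A' rfl B' hB' b hb_tp f' hf' hb_lam.symm
  refine ⟨b', ⟨hb'_tp, (hD.totalLam_eq _ _ _ _ hb').trans hb'_lam⟩, ?_⟩
  rintro c' ⟨rfl, rfl⟩
  have hc' := hD.matches_baseFam rfl D.base.tm c'
  obtain rfl : hD.baseFam rfl D.base.tm c' = b :=
    hb_unique _ ⟨hD.matches_unique hc'.mapTp hB', by rw [totalLam, D.base_lam]⟩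
  exact hb'_unique c' ⟨rfl, hc', rfl⟩

/-- The boolean eliminator of the total model. -/
noncomputable def totalBoolElim {Γ : P} (Q : Fam D.toTypeFamily (D.bool Γ) D.Ty)
    (t f b : D.Tm.obj (op Γ)) (ht : ap D.tp t = Q.at' (D.tt Γ) (D.tp_tt Γ))
    (hf : ap D.tp f = Q.at' (D.ff Γ) (D.tp_ff Γ)) (hb : ap D.tp b = D.bool Γ) :
    D.Tm.obj (op Γ) :=
  D.boolElim (hD.baseFam (D.base_bool Γ) D.base.ty Q) Q
    (hD.matches_baseFam (D.base_bool Γ) D.base.ty Q) t f b ht hf hb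

theorem totalBoolElim_eq {Γ : P} (Q₀ : Fam M.toTypeFamily (M.bool (G.obj Γ)) M.Ty)
    (Q : Fam D.toTypeFamily (D.bool Γ) D.Ty) (hQ : D.base.Matches (D.base_bool Γ) D.base.ty Q Q₀)
    (t f b : D.Tm.obj (op Γ)) (ht hf hb) :
    hD.totalBoolElim Q t f b ht hf hb = D.boolElim Q₀ Q hQ t f b ht hf hb := by
  obtain rfl := hD.baseFam_eq hQ
  rfl

/-- The total model of a displayed model with context extensions: its types and terms are the
displayed ones, paired with their bases. -/
noncomputable def total : Model.{t} P where
  toTypeFamily := D.toTypeFamily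
  hasTerminal := hD.hasTerminal
  rep := hD.rep
  Pi := hD.totalPi
  Pi_res σ _ _ := by
    rw [totalPi, D.Pi_res σ _ _ _ _ _ (by rw [act_res])]
    exact (hD.totalPi_eq _ _ _ _ _).symm
  lam := hD.totalLam
  lam_res σ _ _ := by
    rw [totalLam, D.lam_res σ _ _ _ _ _ (by rw [act_res])]
    exact (hD.totalLam_eq _ _ _ _ _).symm
  tp_lam _ _ := by
    rw [totalLam, D.tp_lam]
    exact (hD.totalPi_eq _ _ _ _ _).symm
  lam_bijective := hD.existsUnique_totalLam
  bool := D.bool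
  bool_res := D.bool_res
  tt := D.tt
  tt_res := D.tt_res
  tp_tt := D.tp_tt
  ff := D.ff
  ff_res := D.ff_res
  tp_ff := D.tp_ff
  boolElim := hD.totalBoolElim
  tp_boolElim _ _ _ _ _ _ _ := D.tp_boolElim _ _ _ _ _ _ _ _ _
  boolElim_res σ _ _ _ _ _ _ _ ht' hf' hb' := by
    rw [totalBoolElim, D.boolElim_res σ _ _ _ _ _ _ _ _ _ ht' hf' hb']
    exact (hD.totalBoolElim_eq _ _ _ _ _ _ _ _ _).symm
  boolElim_tt _ _ _ _ _ := D.boolElim_tt _ _ _ _ _ _ _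
  boolElim_ff _ _ _ _ _ := D.boolElim_ff _ _ _ _ _ _ _

/-- The projection of the total model to the base model. -/
noncomputable def totalProj : ModelHom hD.total M where
  functor := G
  map := D.base
  terminal := hD.terminal
  ext := hD.ext
  Pi A' B' B hB := (congrArg (act D.base.ty) (hD.totalPi_eq B A' rfl B' hB)).trans
    (D.base_Pi B A' rfl B' hB)
  lam A' b' b hb := (congrArg (act D.base.tm) (hD.totalLam_eq b A' rfl b' hb)).trans
    (D.base_lam b A' rfl b' hb)
  bool := D.base_bool
  tt := D.base_tt
  ff := D.base_ff
  boolElim Q Q₀ hQ t f b ht hf hb ht' hf' hb' :=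
    (congrArg (act D.base.tm) (hD.totalBoolElim_eq Q₀ Q hQ t f b ht hf hb)).trans
      (D.base_boolElim Q₀ Q hQ t f b ht hf hb ht' hf' hb')

end HasContextExtensions

end DispModel

/-! ### Models with a lifted set of objects -/

section Lift

attribute [local instance] uliftCategory

variable {C : Type o₁} [Category.{h₁} C]

/-- The type family on `ULift C` induced by a type family on `C`. -/
def TypeFamily.ulift (T : TypeFamily.{t} C) : TypeFamily.{t} (ULift.{o₂} C) where
  Ty := ULift.downFunctor.op ⋙ T.Ty
  Tm := ULift.downFunctor.op ⋙ T.Tm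
  tp := Functor.whiskerLeft ULift.downFunctor.op T.tp

/-- A family over `ULift C`, as a family over `C`. -/
def Fam.down {T : TypeFamily.{t} C} {Γ : ULift.{o₂} C} {A : T.Ty.obj (op Γ.down)}
    {X : Cᵒᵖ ⥤ Type t}
    (B : Fam (TypeFamily.ulift.{t, h₁, o₁, o₂} T) (Γ := Γ) A (ULift.downFunctor.op ⋙ X)) :
    Fam T A X where
  val {Δ} σ a h := B.val (Δ := ⟨Δ⟩) σ a h
  val_res {Δ Θ} τ σ a h := B.val_res (Δ := ⟨Δ⟩) (Θ := ⟨Θ⟩) τ σ a h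

/-- A family over `C`, as a family over `ULift C`. -/
def Fam.up {T : TypeFamily.{t} C} {Γ : ULift.{o₂} C} {A : T.Ty.obj (op Γ.down)}
    {X : Cᵒᵖ ⥤ Type t} (B : Fam T A X) :
    Fam (TypeFamily.ulift.{t, h₁, o₁, o₂} T) (Γ := Γ) A (ULift.downFunctor.op ⋙ X) where
  val {Δ} σ a h := B.val (Δ := Δ.down) σ a h
  val_res {Δ Θ} τ σ a h := B.val_res (Δ := Δ.down) (Θ := Θ.down) τ σ a h

/-- Terminality of the image in `ULift C` of a terminal object of `C`. -/
def isTerminalULiftUp {X : C} (hX : IsTerminal X) : IsTerminal (ULift.up.{o₂} X) :=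
  IsTerminal.ofUniqueHom (fun Y => hX.from Y.down) fun Y m => hX.hom_ext (Y := Y.down) m _

/-- The model on `ULift C` induced by a model on `C`, which compares it with models whose sets of
objects are larger. -/
def Model.ulift (M : Model.{t} C) : Model.{t} (ULift.{o₂} C) where
  toTypeFamily := M.toTypeFamily.ulift
  hasTerminal := by
    have := M.hasTerminal
    exact (isTerminalULiftUp terminalIsTerminal).hasTerminal
  rep Γ A := by
    obtain ⟨E, p, q, hE⟩ := M.rep Γ.down A
    exact ⟨⟨E⟩, p, q, hE.isOver, fun {Δ} σ y h => hE.existsUnique_lift (Δ := Δ.down) σ y h⟩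
  Pi A B := M.Pi A B.down
  Pi_res σ A B := M.Pi_res σ A B.down
  lam A b := M.lam A b.down
  lam_res σ A b := M.lam_res σ A b.down
  tp_lam A b := M.tp_lam A b.down
  lam_bijective A B f h := by
    obtain ⟨b, ⟨hb, hbf⟩, hbu⟩ := M.lam_bijective A B.down f h
    refine ⟨b.up, ⟨congrArg Fam.up hb, hbf⟩, ?_⟩
    rintro b' ⟨hb', hbf'⟩
    exact congrArg Fam.up (hbu b'.down ⟨congrArg Fam.down hb', hbf'⟩)
  bool Γ := M.bool Γ.down
  bool_res σ := M.bool_res σ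
  tt Γ := M.tt Γ.down
  tt_res σ := M.tt_res σ
  tp_tt Γ := M.tp_tt Γ.down
  ff Γ := M.ff Γ.down
  ff_res σ := M.ff_res σ
  tp_ff Γ := M.tp_ff Γ.down
  boolElim P t f b ht hf hb := M.boolElim P.down t f b ht hf hb
  tp_boolElim P t f b ht hf hb := M.tp_boolElim P.down t f b ht hf hb
  boolElim_res σ P t f b ht hf hb ht' hf' hb' := M.boolElim_res σ P.down t f b ht hf hb ht' hf' hb'
  boolElim_tt P t f ht hf := M.boolElim_tt P.down t f ht hf
  boolElim_ff P t f ht hf := M.boolElim_ff P.down t f ht hf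

theorem Fam.down_eq_of_val_eq {T : TypeFamily.{t} C} {Γ : C} {A : T.Ty.obj (op Γ)}
    {X : Cᵒᵖ ⥤ Type t} {B : Fam T A X}
    {B' : Fam (TypeFamily.ulift.{t, h₁, o₁, o₂} T) (Γ := ⟨Γ⟩) A (ULift.downFunctor.op ⋙ X)}
    (h : ∀ ⦃Δ : C⦄ (σ : Δ ⟶ Γ) (a : T.Tm.obj (op Δ)) (h : ap T.tp a = res T.Ty σ A),
      B'.val (Δ := ⟨Δ⟩) σ a h = B.val σ a h) : B'.down = B :=
  Fam.ext_val fun _ σ a ha => h σ a ha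

/-- The canonical morphism from a model on `C` to the induced model on `ULift C`. -/
def Model.upHom (M : Model.{t} C) : ModelHom M (Model.ulift.{t, h₁, o₁, o₂} M) where
  functor := ULift.upFunctor
  map := { ty := 𝟙 M.Ty, tm := 𝟙 M.Tm, tp_tm := fun _ => rfl }
  terminal X hX := hX.map isTerminalULiftUp
  ext _ _ _ _ _ h := ⟨h.isOver, fun {Δ} σ y h' => h.existsUnique_lift (Δ := Δ.down) σ y h'⟩
  Pi A _ _ h := congrArg (M.Pi A) (Fam.down_eq_of_val_eq h).symm
  lam A _ _ h := congrArg (M.lam A) (Fam.down_eq_of_val_eq h).symm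
  bool _ := rfl
  tt _ := rfl
  ff _ := rfl
  boolElim _ _ h _ _ _ _ _ _ _ _ _ := by
    obtain rfl := Fam.down_eq_of_val_eq h
    rfl

end Lift

/-! ### Sections of displayed models over a biinitial model -/

section Section

attribute [local instance] uliftCategory

variable {P : Type o₁} [Category.{h₁} P] {S : Type o₂} [Category.{h₂} S] {G : P ⥤ S}
  {M : Model.{t} S} {D : DispModel G M}

/-- The section of a displayed model given by a section, up to a natural isomorphism, of the
projection of its total model. -/
noncomputable def DispModel.HasContextExtensions.sectionOfHom (hD : D.HasContextExtensions)
    (f : ModelHom M hD.total) (iso : f.functor ⋙ G ≅ 𝟭 S)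
    (base_ty : ∀ {Γ : S} (A : M.Ty.obj (op Γ)),
      act D.base.ty (act f.map.ty A) = res M.Ty (iso.hom.app Γ) A)
    (base_tm : ∀ {Γ : S} (a : M.Tm.obj (op Γ)),
      act D.base.tm (act f.map.tm a) = res M.Tm (iso.hom.app Γ) a) : DispSection D where
  functor := f.functor
  iso := iso
  map := f.map
  base_ty := base_ty
  base_tm := base_tm
  terminal := f.terminal
  ext := f.ext
  Pi A B B' h hB := (f.Pi A B B' h).trans (hD.totalPi_eq _ _ _ _ hB)
  lam A b b' h hb := (f.lam A b b' h).trans (hD.totalLam_eq _ _ _ _ hb)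
  bool := f.bool
  tt := f.tt
  ff := f.ff
  boolElim Q Q' h hQ t e b ht he hb ht' he' hb' :=
    (f.boolElim Q Q' h t e b ht he hb ht' he' hb').trans (hD.totalBoolElim_eq _ _ hQ _ _ _ _ _ _)

theorem Model.IsBiinitial.nonempty_dispSection {S : Type o₂} [Category.{h₁} S] {M : Model.{t} S}
    (hM : Model.IsBiinitial.{o₂, h₁, t, max o₁ o₂, h₁} M) {P : Type (max o₁ o₂)} [Category.{h₁} P]
    {G : P ⥤ S} {D : DispModel G M} (hD : D.HasContextExtensions) : Nonempty (DispSection D) := by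
  obtain ⟨f⟩ := (hM P hD.total).1
  obtain ⟨θ, hθ, -⟩ :=
    (hM (ULift.{o₁} S) M.ulift).2 ((f.comp hD.totalProj).comp M.upHom) M.upHom
  exact ⟨hD.sectionOfHom f (Functor.isoWhiskerRight θ ULift.downFunctor) hθ.ty hθ.tm⟩

end Section

/-! ### Displayed inserters -/

namespace Inserter

variable {C : Type u} [Category.{u} C] {S : Type u} [Category.{u} S] {F : C ⥤ S}
  {M : Model.{u} S} {D : DispModel F M} {𝓕 : Factorization D} {S₀ : DispSection 𝓕.disp}

theorem hom_ext {X X' : Inserter 𝓕 S₀} {θ θ' : X ⟶ X'} (h : θ.hom = θ'.hom) : θ = θ' :=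
  Hom.ext h

theorem map_sTy (X : Inserter 𝓕 S₀) (A : M.Ty.obj (op (F.obj X.pt))) :
    act 𝓕.map.ty (X.sTy A) = res 𝓕.disp.Ty X.ι (act S₀.map.ty A) :=
  (Equiv.ofBijective _ (𝓕.bij_ty X.pt)).apply_symm_apply _

theorem map_sTm (X : Inserter 𝓕 S₀) (a : M.Tm.obj (op (F.obj X.pt))) :
    act 𝓕.map.tm (X.sTm a) = res 𝓕.disp.Tm X.ι (act S₀.map.tm a) :=
  (Equiv.ofBijective _ (𝓕.bij_tm X.pt)).apply_symm_apply _

theorem sTm_eq_iff (X : Inserter 𝓕 S₀) (a : M.Tm.obj (op (F.obj X.pt))) (a' : D.Tm.obj (op X.pt)) :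
    X.sTm a = a' ↔ res 𝓕.disp.Tm X.ι (act S₀.map.tm a) = act 𝓕.map.tm a' := by
  rw [← map_sTm]
  exact (𝓕.bij_tm X.pt).1.eq_iff.symm

theorem sTm_res {X X' : Inserter 𝓕 S₀} (θ : X ⟶ X') (a : M.Tm.obj (op (F.obj X'.pt))) :
    X.sTm (res M.Tm (F.map θ.hom) a) = res D.Tm θ.hom (X'.sTm a) := by
  rw [sTm_eq_iff, act_res, act_res, map_sTm, ← res_comp, ← res_comp, θ.comm]

variable (S₀) in
theorem exists_isTerminal (_ : HasTerminal C) (hF : PreservesTerminal F) :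
    ∃ X : Inserter 𝓕 S₀, Nonempty (IsTerminal X) ∧ Nonempty (IsTerminal X.pt) := by
  have hC : IsTerminal (⊤_ C) := terminalIsTerminal
  obtain ⟨hS⟩ := hF _ ⟨hC⟩
  obtain ⟨hP⟩ := S₀.terminal _ ⟨hS⟩
  refine ⟨⟨⊤_ C, hP.from _, hS.hom_ext _ _⟩, ⟨IsTerminal.ofUniqueHom
    (fun Z => ⟨hC.from Z.pt, hP.hom_ext _ _⟩) fun Z m => hom_ext (hC.hom_ext _ _)⟩, ⟨hC⟩⟩

section Extend

variable (X : Inserter 𝓕 S₀) {A : M.Ty.obj (op (F.obj X.pt))} {E : C} {p : E ⟶ X.pt}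
  {a : M.Tm.obj (op (F.obj E))} (hE : IsExtension M.tp A (F.map p) a) {a' : D.Tm.obj (op E)}

theorem tp_map_tm (htp : ap D.tp a' = res D.Ty p (X.sTy A)) : ap 𝓕.disp.tp (act 𝓕.map.tm a') =
    res 𝓕.disp.Ty (𝓕.Y.map p ≫ X.ι) (act S₀.map.ty A) := by
  rw [𝓕.map.tp_tm, htp, act_res, map_sTy, res_comp]

variable (htp : ap D.tp a' = res D.Ty p (X.sTy A))

/-- The morphism `⟨ι, a'⟩ : Y (Γ.A) ⟶ S₀ (F (Γ.A))` determined by a displayed term `a'` of type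
`S_ι A` over the generic term `a` of the context extension of `F Γ` by `A`. -/
noncomputable def extendι : 𝓕.Y.obj E ⟶ S₀.functor.obj (F.obj E) :=
  (S₀.ext A (F.map p) a hE).lift (𝓕.Y.map p ≫ X.ι) (act 𝓕.map.tm a') (X.tp_map_tm htp)

theorem extendι_p :
    X.extendι hE htp ≫ S₀.functor.map (F.map p) = 𝓕.Y.map p ≫ X.ι :=
  IsExtension.lift_p _ _ _ _

theorem res_extendι :
    res 𝓕.disp.Tm (X.extendι hE htp) (act S₀.map.tm a) = act 𝓕.map.tm a' :=
  IsExtension.res_lift_q _ _ _ _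

theorem extendι_isOver (hbase : act D.base.tm a' = a) :
    𝓕.G.map (X.extendι hE htp) ≫ S₀.iso.hom.app (F.obj E) = 𝓕.fac.hom.app E := by
  refine hE.hom_ext ?_ ?_
  · calc (𝓕.G.map (X.extendι hE htp) ≫ S₀.iso.hom.app (F.obj E)) ≫ F.map p
      _ = 𝓕.G.map (X.extendι hE htp) ≫ 𝓕.G.map (S₀.functor.map (F.map p)) ≫
            S₀.iso.hom.app (F.obj X.pt) := by
          rw [Category.assoc]; exact congrArg _ (S₀.iso.hom.naturality (F.map p)).symm
      _ = 𝓕.G.map (𝓕.Y.map p) ≫ 𝓕.G.map X.ι ≫ S₀.iso.hom.app (F.obj X.pt) := by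
          rw [← 𝓕.G.map_comp_assoc, extendι_p, 𝓕.G.map_comp_assoc]
      _ = 𝓕.fac.hom.app E ≫ F.map p := by
          rw [X.isOver]; exact 𝓕.fac.hom.naturality p
  · rw [res_comp, ← S₀.base_tm, ← act_res, res_extendι, 𝓕.base_tm, hbase]

variable (hbase : act D.base.tm a' = a)

/-- The extension of the object `X` of the displayed inserter by the displayed term `a'`. -/
noncomputable def extend : Inserter 𝓕 S₀ :=
  ⟨E, X.extendι hE htp, X.extendι_isOver hE htp hbase⟩

/-- The projection from the extension of `X` to `X`. -/
noncomputable def extendProj : X.extend hE htp hbase ⟶ X :=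
  ⟨p, (X.extendι_p hE htp).symm⟩

theorem sTm_extend : (X.extend hE htp hbase).sTm a = a' :=
  (sTm_eq_iff _ _ _).mpr (X.res_extendι hE htp)

/-- The lift `⟨σ, a'[τ]⟩` of a morphism `σ` to the extension of `X`, with underlying
morphism `τ`. -/
noncomputable def extendLift {Z : Inserter 𝓕 S₀} (σ : Z ⟶ X) (τ : Z.pt ⟶ E) (hp : τ ≫ p = σ.hom)
    (ha : Z.sTm (res M.Tm (F.map τ) a) = res D.Tm τ a') : Z ⟶ X.extend hE htp hbase where
  hom := τ
  comm := by
    refine (S₀.ext A (F.map p) a hE).hom_ext ?_ ?_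
    · calc (𝓕.Y.map τ ≫ X.extendι hE htp) ≫ S₀.functor.map (F.map p)
        _ = 𝓕.Y.map σ.hom ≫ X.ι := by
            rw [Category.assoc, extendι_p, ← 𝓕.Y.map_comp_assoc, hp]
        _ = (Z.ι ≫ S₀.functor.map (F.map τ)) ≫ S₀.functor.map (F.map p) := by
            rw [σ.comm, Category.assoc, ← S₀.functor.map_comp, ← F.map_comp, hp]
    · calc res 𝓕.disp.Tm (𝓕.Y.map τ ≫ X.extendι hE htp) (act S₀.map.tm a)
        _ = act 𝓕.map.tm (Z.sTm (res M.Tm (F.map τ) a)) := by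
            rw [res_comp, res_extendι, ha, act_res]
        _ = res 𝓕.disp.Tm (Z.ι ≫ S₀.functor.map (F.map τ)) (act S₀.map.tm a) := by
            rw [map_sTm, act_res, res_comp]

end Extend

section Transport

variable (X : Inserter 𝓕 S₀) {x : C} (e : X.pt ≅ x)

theorem transport_isOver :
    𝓕.G.map (𝓕.Y.map e.inv ≫ X.ι ≫ S₀.functor.map (F.map e.hom)) ≫ S₀.iso.hom.app (F.obj x) =
      𝓕.fac.hom.app x := by
  have iso_naturality : 𝓕.G.map (S₀.functor.map (F.map e.hom)) ≫ S₀.iso.hom.app (F.obj x) =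
      S₀.iso.hom.app (F.obj X.pt) ≫ F.map e.hom := S₀.iso.hom.naturality (F.map e.hom)
  have fac_naturality : 𝓕.G.map (𝓕.Y.map e.inv) ≫ 𝓕.fac.hom.app X.pt =
      𝓕.fac.hom.app x ≫ F.map e.inv := 𝓕.fac.hom.naturality e.inv
  calc 𝓕.G.map (𝓕.Y.map e.inv ≫ X.ι ≫ S₀.functor.map (F.map e.hom)) ≫ S₀.iso.hom.app (F.obj x)
    _ = 𝓕.G.map (𝓕.Y.map e.inv) ≫ (𝓕.G.map X.ι ≫ S₀.iso.hom.app (F.obj X.pt)) ≫ F.map e.hom := by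
        simp only [Functor.map_comp, Category.assoc, iso_naturality]
    _ = 𝓕.fac.hom.app x ≫ F.map e.inv ≫ F.map e.hom := by
        rw [X.isOver, ← Category.assoc, fac_naturality, Category.assoc]
    _ = 𝓕.fac.hom.app x := by
        rw [← F.map_comp, e.inv_hom_id, F.map_id, Category.comp_id]

/-- The transport of an object of the displayed inserter along an isomorphism of `C`. -/
def transport : Inserter 𝓕 S₀ :=
  ⟨x, 𝓕.Y.map e.inv ≫ X.ι ≫ S₀.functor.map (F.map e.hom), X.transport_isOver e⟩

/-- The isomorphism of the displayed inserter over `e` along which `transport` transports. -/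
def transportIso : X ≅ X.transport e where
  hom := ⟨e.hom, by simp [transport, ← Functor.map_comp_assoc]⟩
  inv := ⟨e.inv, by simp [transport, ← Functor.map_comp]⟩
  hom_inv_id := hom_ext e.hom_inv_id
  inv_hom_id := hom_ext e.inv_hom_id

end Transport

end Inserter

/-- The relative section determined by a section, up to isomorphism, of the projection of the
displayed inserter. -/
def RelativeSection.ofFunctor {C : Type u} [Category.{u} C] {S : Type u} [Category.{u} S]
    {F : C ⥤ S} {M : Model.{u} S} {D : DispModel F M} {𝓕 : Factorization D}
    {S₀ : DispSection 𝓕.disp} (K : C ⥤ Inserter 𝓕 S₀) (i : ∀ x : C, (K.obj x).pt ≅ x)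
    (hi : ∀ {x y : C} (f : x ⟶ y), (K.map f).hom ≫ (i y).hom = (i x).hom ≫ f) :
    RelativeSection 𝓕 S₀ where
  α :=
    { app x := ((K.obj x).transport (i x)).ι
      naturality x y f := by
        let θ : (K.obj x).transport (i x) ⟶ (K.obj y).transport (i y) :=
          ((K.obj x).transportIso (i x)).inv ≫ K.map f ≫ ((K.obj y).transportIso (i y)).hom
        have θ_hom : θ.hom = f := (Iso.inv_comp_eq (i x)).mpr (hi f)
        exact θ_hom ▸ θ.comm }
  isOver x := ((K.obj x).transport (i x)).isOver

/-! ### The renaming algebra on the displayed inserter -/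

namespace VarInterpretation

variable {S : Type u} [Category.{u} S] {M : Model.{u} S} {R : Type u} [Category.{u} R]
  {𝓡 : RenamingAlgebra M R} {D : DispModel 𝓡.F M} {𝓕 : Factorization D}
  {S₀ : DispSection 𝓕.disp} (var' : VarInterpretation 𝓡 𝓕 S₀)

theorem val_congr (X : Inserter 𝓕 S₀) {A A' : M.Ty.obj (op (𝓡.F.obj X.pt))} {y : R}
    {ρ ρ' : y ⟶ X.pt} {a a' : 𝓡.Var.obj (op y)} (h : act 𝓡.vtp a = res M.Ty (𝓡.F.map ρ) A)
    (hA : A = A') (hρ : ρ = ρ') (ha : a = a') :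
    var'.val X A ρ a h = var'.val X A' ρ' a' (by rw [← hA, ← hρ, ← ha, h]) := by
  subst hA hρ ha
  rfl

/-- The displayed interpretation of a variable over the object of the inserter itself. -/
def interp (X : Inserter 𝓕 S₀) (a : 𝓡.Var.obj (op X.pt)) : D.Tm.obj (op X.pt) :=
  var'.val X (act 𝓡.vtp a) (𝟙 X.pt) a (𝓡.vtp_id a)

theorem interp_eq_val {X X' : Inserter 𝓕 S₀} (θ : X ⟶ X') (A : M.Ty.obj (op (𝓡.F.obj X'.pt)))
    (a : 𝓡.Var.obj (op X.pt)) (h : act 𝓡.vtp a = res M.Ty (𝓡.F.map θ.hom) A) :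
    var'.interp X a = var'.val X' A θ.hom a h := by
  have h_id_comp : act 𝓡.vtp a = res M.Ty (𝓡.F.map (𝟙 X.pt ≫ θ.hom)) A := by
    rw [Category.id_comp, h]
  rw [interp, var'.val_congr X _ h rfl rfl, var'.val_map θ A (𝟙 X.pt) a _ h_id_comp]
  exact var'.val_congr X' _ rfl (Category.id_comp _) rfl

theorem res_interp {X X' : Inserter 𝓕 S₀} (θ : X ⟶ X') (a : 𝓡.Var.obj (op X'.pt)) :
    res D.Tm θ.hom (var'.interp X' a) = var'.interp X (res 𝓡.Var θ.hom a) := by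
  have h : act 𝓡.vtp (res 𝓡.Var θ.hom a) = res M.Ty (𝓡.F.map θ.hom) (act 𝓡.vtp a) :=
    act_res 𝓡.vtp θ.hom a
  rw [var'.interp_eq_val θ (act 𝓡.vtp a) _ h, interp,
    var'.val_res _ _ θ.hom (𝟙 _) a _ (by rw [Category.comp_id, h])]
  exact var'.val_congr X' _ rfl (Category.comp_id _) rfl

/-- The action `S_ι` on terms sends the variable `a` to its displayed interpretation. -/
def Agrees (X : Inserter 𝓕 S₀) (a : 𝓡.Var.obj (op X.pt)) : Prop :=
  X.sTm (act 𝓡.var a) = var'.interp X a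

variable {var'} in
theorem Agrees.res {X X' : Inserter 𝓕 S₀} (θ : X ⟶ X') {a : 𝓡.Var.obj (op X'.pt)}
    (h : var'.Agrees X' a) : var'.Agrees X (res 𝓡.Var θ.hom a) := by
  rw [Agrees, act_res, Inserter.sTm_res, h, res_interp]

/-- The presheaf over the displayed inserter of the variables that are sent to their displayed
interpretations. -/
def agreeing : Subfunctor ((Inserter.proj 𝓕 S₀).op ⋙ 𝓡.Var) where
  obj X := {a | var'.Agrees X.unop a}
  map θ _ h := Agrees.res θ.unop h

/-- The types of the variables that are sent to their displayed interpretations. -/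
def vtp : var'.agreeing.toFunctor ⟶ (Inserter.proj 𝓕 S₀ ⋙ 𝓡.F).op ⋙ M.Ty :=
  var'.agreeing.ι ≫ Functor.whiskerLeft (Inserter.proj 𝓕 S₀).op 𝓡.vtp

-- The generic variable `q` of a context extension can be made to agree with its interpretation by
-- taking that interpretation as the last component of `ι`.
theorem exists_isExtension (X : Inserter 𝓕 S₀) (A : M.Ty.obj (op (𝓡.F.obj X.pt))) :
    ∃ (X' : Inserter 𝓕 S₀) (θ : X' ⟶ X) (q : var'.agreeing.toFunctor.obj (op X')),
      IsExtension var'.vtp A θ q ∧ IsExtension 𝓡.vtp A θ.hom q.1 := by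
  obtain ⟨E, p, q, hE⟩ := 𝓡.rep X.pt A
  have hq : act 𝓡.vtp q = res M.Ty (𝓡.F.map p) A := hE.isOver
  have hFE : IsExtension M.tp A (𝓡.F.map p) (act 𝓡.var q) := 𝓡.ext A p q hE
  have htp := var'.tp_val X A p q hq
  have hbase := var'.base_val X A p q hq
  let X' := X.extend hFE htp hbase
  let θ : X' ⟶ X := X.extendProj hFE htp hbase
  have agrees_q : var'.Agrees X' q :=
    (X.sTm_extend hFE htp hbase).trans (var'.interp_eq_val θ A q hq).symm
  refine ⟨X', θ, ⟨q, agrees_q⟩, ⟨hE.isOver, fun {Z} σ a ha => ?_⟩, hE⟩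
  obtain ⟨τ, ⟨hτp, hτq⟩, -⟩ := hE.existsUnique_lift σ.hom a.1 ha
  have sTm_var : Z.sTm (res M.Tm (𝓡.F.map τ) (act 𝓡.var q)) =
      res D.Tm τ (var'.val X A p q hq) := by
    rw [← act_res, hτq, a.2, var'.interp_eq_val σ A a.1 ha,
      var'.val_res X A τ p q hq (by rw [hτp, hτq]; exact ha)]
    exact (var'.val_congr X _ rfl hτp hτq).symm
  refine ⟨X.extendLift hFE htp hbase σ τ hτp sTm_var,
    ⟨Inserter.hom_ext hτp, Subtype.ext hτq⟩, ?_⟩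
  rintro τ' ⟨hp, hq'⟩
  exact Inserter.hom_ext (hE.hom_ext ((congrArg Inserter.Hom.hom hp).trans hτp.symm)
    ((congrArg Subtype.val hq').trans hτq.symm))

/-- The renaming algebra on the displayed inserter whose variables are the variables that are sent
to their displayed interpretations. -/
def algebra : RenamingAlgebra M (Inserter 𝓕 S₀) where
  F := Inserter.proj 𝓕 S₀ ⋙ 𝓡.F
  hasTerminal := by
    obtain ⟨X, ⟨hX⟩, -⟩ := Inserter.exists_isTerminal S₀ 𝓡.hasTerminal 𝓡.terminal
    exact hX.hasTerminal
  terminal := by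
    obtain ⟨X, ⟨hX⟩, hR⟩ := Inserter.exists_isTerminal S₀ 𝓡.hasTerminal 𝓡.terminal
    obtain ⟨hF⟩ := 𝓡.terminal _ hR
    exact PreservesTerminal.of_isTerminal hX hF
  Var := var'.agreeing.toFunctor
  vtp := var'.vtp
  rep X A := by
    obtain ⟨X', θ, q, h, -⟩ := var'.exists_isExtension X A
    exact ⟨X', θ, q, h⟩
  var := var'.agreeing.ι ≫ Functor.whiskerLeft (Inserter.proj 𝓕 S₀).op 𝓡.var
  tp_var a := 𝓡.tp_var a.1
  ext := PreservesExtensions.of_exists fun X A => by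
    obtain ⟨X', θ, q, h, h'⟩ := var'.exists_isExtension X A
    exact ⟨X', θ, q, h, 𝓡.ext A θ.hom q.1 h'⟩

/-- The projection of the displayed inserter as a morphism of renaming algebras. -/
def algebraProj : RenamingHom var'.algebra 𝓡 where
  functor := Inserter.proj 𝓕 S₀
  iso := Iso.refl _
  onVar := var'.agreeing.ι
  vtp_onVar _ := (res_id M.Ty _).symm
  var_onVar _ := (res_id M.Tm _).symm
  terminal := by
    obtain ⟨X, ⟨hX⟩, ⟨hR⟩⟩ := Inserter.exists_isTerminal S₀ 𝓡.hasTerminal 𝓡.terminal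
    exact PreservesTerminal.of_isTerminal hX hR
  ext := PreservesExtensions.of_exists fun X A => by
    obtain ⟨X', θ, q, h, h'⟩ := var'.exists_isExtension X A
    exact ⟨X', θ, q, h, h'.congr (res_id M.Ty A).symm⟩

end VarInterpretation

namespace RenamingHom

variable {S : Type o₂} [Category.{h₂} S] {M : Model.{t} S}

/-- The identity morphism of a renaming algebra. -/
def id {R : Type o₁} [Category.{h₁} R] (𝓡 : RenamingAlgebra M R) : RenamingHom 𝓡 𝓡 where
  functor := 𝟭 R
  iso := 𝓡.F.leftUnitor
  onVar := 𝟙 𝓡.Var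
  vtp_onVar _ := (res_id M.Ty _).symm
  var_onVar _ := (res_id M.Tm _).symm
  terminal _ h := h
  ext _ A _ _ _ h := h.congr (res_id M.Ty A).symm

/-- The composite of two morphisms of renaming algebras. -/
def comp {R₁ R₂ R₃ : Type o₁} [Category.{h₁} R₁] [Category.{h₁} R₂] [Category.{h₁} R₃]
    {𝓡₁ : RenamingAlgebra M R₁} {𝓡₂ : RenamingAlgebra M R₂} {𝓡₃ : RenamingAlgebra M R₃}
    (f : RenamingHom 𝓡₁ 𝓡₂) (g : RenamingHom 𝓡₂ 𝓡₃) : RenamingHom 𝓡₁ 𝓡₃ where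
  functor := f.functor ⋙ g.functor
  iso := Functor.isoWhiskerLeft f.functor g.iso ≪≫ f.iso
  onVar := f.onVar ≫ Functor.whiskerLeft f.functor.op g.onVar
  vtp_onVar a := by
    refine (g.vtp_onVar (act f.onVar a)).trans ?_
    rw [f.vtp_onVar, ← res_comp]
    rfl
  var_onVar a := by
    refine (g.var_onVar (act f.onVar a)).trans ?_
    rw [f.var_onVar, ← res_comp]
    rfl
  terminal X h := g.terminal _ (f.terminal X h)
  ext _ A _ _ _ h := (g.ext _ _ _ (f.ext _ _ _ h)).congr (res_comp M.Ty _ _ A).symm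

end RenamingHom

theorem RenamingAlgebra.IsBiinitial.exists_relativeSection {S : Type u} [Category.{u} S]
    {M : Model.{u} S} {R : Type u} [Category.{u} R] {𝓡 : RenamingAlgebra M R}
    (h𝓡 : 𝓡.IsBiinitial) {D : DispModel 𝓡.F M} {𝓕 : Factorization D} {S₀ : DispSection 𝓕.disp}
    (var' : VarInterpretation 𝓡 𝓕 S₀) :
    ∃ s : RelativeSection 𝓕 S₀, ∀ (x : R) (a : 𝓡.Var.obj (op x)),
      var'.Agrees (s.toInserter.obj x) a := by
  obtain ⟨k⟩ := (h𝓡 _ var'.algebra).1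
  obtain ⟨θ, hθ, -⟩ := (h𝓡 _ 𝓡).2 (k.comp var'.algebraProj) (RenamingHom.id 𝓡)
  let i (x : R) : (k.functor.obj x).pt ≅ x := θ.app x
  refine ⟨RelativeSection.ofFunctor k.functor i (fun f => θ.hom.naturality f), fun x a => ?_⟩
  have onVar_eq : (act k.onVar a).1 = res 𝓡.Var (i x).hom a := hθ.onVar a
  have res_onVar : res 𝓡.Var (i x).inv (act k.onVar a).1 = a := by
    rw [onVar_eq, ← res_comp, Iso.inv_hom_id, res_id]
  have agrees := (act k.onVar a).2.res ((k.functor.obj x).transportIso (i x)).inv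
  exact (congrArg (var'.Agrees _) res_onVar).mp agrees

/-! ### Extensionality of the displayed operations -/

namespace DispModel

variable {C : Type o₁} [Category.{h₁} C] {S : Type o₂} [Category.{h₂} S] {F : C ⥤ S}
  {M : Model.{t} S} (D : DispModel F M) {Γ : C}

theorem Pi_congr {A₁ A₂ : M.Ty.obj (op (F.obj Γ))} {B₁ : Fam M.toTypeFamily A₁ M.Ty}
    {B₂ : Fam M.toTypeFamily A₂ M.Ty} {A₁' A₂' : D.Ty.obj (op Γ)} {h₁ h₂}
    {B₁' : Fam D.toTypeFamily A₁' D.Ty} {B₂' : Fam D.toTypeFamily A₂' D.Ty} {hB₁ hB₂}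
    (hA : A₁' = A₂')
    (hB : ∀ (Δ : S) (σ : Δ ⟶ F.obj Γ) (a) (h₁ h₂), B₁.val σ a h₁ = B₂.val σ a h₂)
    (hB' : ∀ (Δ : C) (σ : Δ ⟶ Γ) (a) (h₁ h₂), B₁'.val σ a h₁ = B₂'.val σ a h₂) :
    D.Pi B₁ A₁' h₁ B₁' hB₁ = D.Pi B₂ A₂' h₂ B₂' hB₂ := by
  subst hA h₁ h₂
  obtain rfl : B₁ = B₂ := Fam.ext_val fun Δ σ a h => hB Δ σ a h h
  obtain rfl : B₁' = B₂' := Fam.ext_val fun Δ σ a h => hB' Δ σ a h h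
  rfl

theorem lam_congr {A₁ A₂ : M.Ty.obj (op (F.obj Γ))} {b₁ : Fam M.toTypeFamily A₁ M.Tm}
    {b₂ : Fam M.toTypeFamily A₂ M.Tm} {A₁' A₂' : D.Ty.obj (op Γ)} {h₁ h₂}
    {b₁' : Fam D.toTypeFamily A₁' D.Tm} {b₂' : Fam D.toTypeFamily A₂' D.Tm} {hb₁ hb₂}
    (hA : A₁' = A₂')
    (hb : ∀ (Δ : S) (σ : Δ ⟶ F.obj Γ) (a) (h₁ h₂), b₁.val σ a h₁ = b₂.val σ a h₂)
    (hb' : ∀ (Δ : C) (σ : Δ ⟶ Γ) (a) (h₁ h₂), b₁'.val σ a h₁ = b₂'.val σ a h₂) :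
    D.lam b₁ A₁' h₁ b₁' hb₁ = D.lam b₂ A₂' h₂ b₂' hb₂ := by
  subst hA h₁ h₂
  obtain rfl : b₁ = b₂ := Fam.ext_val fun Δ σ a h => hb Δ σ a h h
  obtain rfl : b₁' = b₂' := Fam.ext_val fun Δ σ a h => hb' Δ σ a h h
  rfl

theorem boolElim_congr {P₁ P₂ : Fam M.toTypeFamily (M.bool (F.obj Γ)) M.Ty}
    {P₁' P₂' : Fam D.toTypeFamily (D.bool Γ) D.Ty} {hP₁ hP₂} {t₁ t₂ f₁ f₂ b₁ b₂ : D.Tm.obj (op Γ)}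
    {ht₁ ht₂ hf₁ hf₂ hb₁ hb₂}
    (hP : ∀ (Δ : S) (σ : Δ ⟶ F.obj Γ) (a) (h), P₁.val σ a h = P₂.val σ a h)
    (hP' : ∀ (Δ : C) (σ : Δ ⟶ Γ) (a) (h), P₁'.val σ a h = P₂'.val σ a h)
    (ht : t₁ = t₂) (hf : f₁ = f₂) (hb : b₁ = b₂) :
    D.boolElim P₁ P₁' hP₁ t₁ f₁ b₁ ht₁ hf₁ hb₁ = D.boolElim P₂ P₂' hP₂ t₂ f₂ b₂ ht₂ hf₂ hb₂ := by
  obtain rfl : P₁ = P₂ := Fam.ext_val hP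
  obtain rfl : P₁' = P₂' := Fam.ext_val hP'
  subst ht hf hb
  rfl

end DispModel

/-! ### The glueing category -/

theorem presheafHom_ext {C : Type o₁} [Category.{h₁} C] {X X' : Cᵒᵖ ⥤ Type t} {f g : X ⟶ X'}
    (h : ∀ (c : C) (x : X.obj (op c)), ap f x = ap g x) : f = g := by
  ext c x
  exact h c.unop x

/-- An object of the glueing of `S` along the nerve of `F : C ⥤ S`: an object `ctx` of `S` with a
presheaf over `C` and a map from it to `c ↦ (F c ⟶ ctx)`. -/
structure Glueing {C : Type u} [Category.{u} C] {S : Type o₂} [Category.{h₂} S] (F : C ⥤ S) where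
  ctx : S
  psh : Cᵒᵖ ⥤ Type u
  π : ∀ {c : C}, psh.obj (op c) → (F.obj c ⟶ ctx)
  π_res : ∀ {c d : C} (σ : d ⟶ c) (z : psh.obj (op c)), π (res psh σ z) = F.map σ ≫ π z

namespace Glueing

variable {C : Type u} [Category.{u} C] {S : Type o₂} [Category.{h₂} S] {F : C ⥤ S}

/-- Morphisms of the glueing category. -/
structure Hom (Z Z' : Glueing F) where
  fst : Z.ctx ⟶ Z'.ctx
  snd : Z.psh ⟶ Z'.psh
  isOver : ∀ {c : C} (z : Z.psh.obj (op c)), Z'.π (ap snd z) = Z.π z ≫ fst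

theorem Hom.ext_ap {Z Z' : Glueing F} {θ θ' : Hom Z Z'} (h₁ : θ.fst = θ'.fst)
    (h₂ : ∀ (c : C) (z : Z.psh.obj (op c)), ap θ.snd z = ap θ'.snd z) : θ = θ' := by
  obtain ⟨f, s, _⟩ := θ
  obtain ⟨f', s', _⟩ := θ'
  obtain rfl : f = f' := h₁
  obtain rfl : s = s' := presheafHom_ext h₂
  rfl

instance : Category (Glueing F) where
  Hom := Hom
  id Z := ⟨𝟙 Z.ctx, 𝟙 Z.psh, fun z => (Category.comp_id _).symm⟩
  comp θ θ' := ⟨θ.fst ≫ θ'.fst, θ.snd ≫ θ'.snd, fun z =>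
    (θ'.isOver (ap θ.snd z)).trans (by rw [θ.isOver, Category.assoc])⟩
  id_comp θ := Hom.ext_ap (Category.id_comp _) fun _ _ => rfl
  comp_id θ := Hom.ext_ap (Category.comp_id _) fun _ _ => rfl
  assoc _ _ _ := Hom.ext_ap (Category.assoc _ _ _) fun _ _ => rfl

variable (F) in
/-- The projection of the glueing category. -/
def proj : Glueing F ⥤ S where
  obj Z := Z.ctx
  map θ := θ.fst

/-- The morphism of `S` given by an element of the presheaf of an object. -/
def pi {Z : Glueing F} {c : C} (z : Z.psh.obj (op c)) : F.obj c ⟶ (proj F).obj Z :=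
  Z.π z

theorem pi_res {Z : Glueing F} {c d : C} (σ : d ⟶ c) (z : Z.psh.obj (op c)) :
    pi (res Z.psh σ z) = F.map σ ≫ pi z :=
  Z.π_res σ z

/-- The action of a morphism on the elements of the presheaves. -/
def push {Z Z' : Glueing F} (θ : Z ⟶ Z') {c : C} (z : Z.psh.obj (op c)) : Z'.psh.obj (op c) :=
  ap θ.snd z

theorem push_res {Z Z' : Glueing F} (θ : Z ⟶ Z') {c d : C} (σ : d ⟶ c) (z : Z.psh.obj (op c)) :
    push θ (res Z.psh σ z) = res Z'.psh σ (push θ z) :=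
  ap_res θ.snd σ z

theorem pi_push {Z Z' : Glueing F} (θ : Z ⟶ Z') {c : C} (z : Z.psh.obj (op c)) :
    pi (push θ z) = pi z ≫ (proj F).map θ :=
  θ.isOver z

theorem hom_ext {Z Z' : Glueing F} {θ θ' : Z ⟶ Z'} (h₁ : (proj F).map θ = (proj F).map θ')
    (h₂ : ∀ (c : C) (z : Z.psh.obj (op c)), push θ z = push θ' z) : θ = θ' :=
  Hom.ext_ap h₁ h₂

variable (F) in
/-- The embedding of `C` into the glueing category. -/
def Y : C ⥤ Glueing F where
  obj c := ⟨F.obj c, yoneda.obj c, fun σ => F.map σ, fun σ τ => F.map_comp σ τ⟩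
  map σ := ⟨F.map σ, yoneda.map σ, fun τ => F.map_comp τ σ⟩
  map_id c := hom_ext (F.map_id c) fun _ σ => Category.comp_id (Y := c) σ
  map_comp {c _ _} σ τ := hom_ext (F.map_comp σ τ) fun _ ρ =>
    (Category.assoc (X := c) ρ σ τ).symm

/-- An element of a representable object. -/
def yo {c d : C} (σ : d ⟶ c) : ((Y F).obj c).psh.obj (op d) :=
  σ

theorem res_yo {c d e : C} (τ : e ⟶ d) (σ : d ⟶ c) :
    res ((Y F).obj c).psh τ (yo σ) = yo (τ ≫ σ) :=
  rfl

theorem push_Y_map {c d e : C} (σ : d ⟶ c) (τ : e ⟶ d) :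
    push ((Y F).map σ) (yo τ) = yo (τ ≫ σ) :=
  rfl

theorem push_yo {Z : Glueing F} {c d : C} (θ : (Y F).obj c ⟶ Z) (σ : d ⟶ c) :
    push θ (yo σ) = res Z.psh σ (push θ (yo (𝟙 c))) := by
  rw [← push_res, res_yo, Category.comp_id]

/-- The morphism from a representable object given by an element. -/
def point {Z : Glueing F} {c : C} (z : Z.psh.obj (op c)) : (Y F).obj c ⟶ Z :=
  ⟨Z.π z, yonedaEquiv.symm z, fun σ => Z.π_res σ z⟩

theorem push_point {Z : Glueing F} {c d : C} (z : Z.psh.obj (op c)) (σ : d ⟶ c) :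
    push (point z) (yo σ) = res Z.psh σ z :=
  rfl

theorem Y_map_point {Z : Glueing F} {c d : C} (σ : d ⟶ c) (z : Z.psh.obj (op c)) :
    (Y F).map σ ≫ point z = point (res Z.psh σ z) :=
  hom_ext (Z.π_res σ z).symm fun _ τ => res_comp Z.psh τ σ z

theorem point_comp {Z Z' : Glueing F} (θ : Z ⟶ Z') {c : C} (z : Z.psh.obj (op c)) :
    point z ≫ θ = point (push θ z) :=
  hom_ext (pi_push θ z).symm fun _ σ => push_res θ σ z

theorem point_yo {c d : C} (σ : d ⟶ c) : point (yo (F := F) σ) = (Y F).map σ :=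
  hom_ext rfl fun _ _ => rfl

instance : (Y F).Full where
  map_surjective {c d} θ := by
    have fst_eq : F.map (𝟙 c) ≫ (proj F).map θ = (proj F).map θ :=
      (congrArg (fun k : F.obj c ⟶ F.obj c => k ≫ (proj F).map θ) (F.map_id c)).trans
        (Category.id_comp (X := F.obj c) _)
    exact ⟨push θ (yo (𝟙 c)),
      hom_ext ((pi_push θ (yo (𝟙 c))).trans fst_eq) fun _ σ => (push_yo θ σ).symm⟩

instance : (Y F).Faithful where
  map_injective {c d f g} h := by
    have push_eq : push ((Y F).map f) (yo (𝟙 c)) = push ((Y F).map g) (yo (𝟙 c)) := by rw [h]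
    rwa [push_Y_map, push_Y_map, Category.id_comp, Category.id_comp] at push_eq

/-! ### Glued presheaves -/

section Glued

variable {X : Cᵒᵖ ⥤ Type u} {X' : Sᵒᵖ ⥤ Type u} {b : X ⟶ F.op ⋙ X'}

/-- The elements of a glued presheaf over `Z`: an element over `Z.ctx` with a displayed element
over it for all elements of `Z.psh`. -/
structure Elt (b : X ⟶ F.op ⋙ X') (Z : Glueing F) where
  fst : X'.obj (op Z.ctx)
  snd : Z.psh ⟶ X
  isOver : ∀ {c : C} (z : Z.psh.obj (op c)), act b (ap snd z) = res X' (Z.π z) fst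

theorem Elt.ext_ap {Z : Glueing F} {e e' : Elt b Z} (h₁ : e.fst = e'.fst)
    (h₂ : ∀ (c : C) (z : Z.psh.obj (op c)), ap e.snd z = ap e'.snd z) : e = e' := by
  obtain ⟨f, s, _⟩ := e
  obtain ⟨f', s', _⟩ := e'
  obtain rfl : f = f' := h₁
  obtain rfl : s = s' := presheafHom_ext h₂
  rfl

variable (b) in
/-- The presheaf over the glueing category that is glued from a map `X ⟶ F^* X'`. -/
def glued : (Glueing F)ᵒᵖ ⥤ Type u where
  obj Z := Elt b Z.unop
  map θ := TypeCat.ofHom fun e => ⟨res X' θ.unop.fst e.fst, θ.unop.snd ≫ e.snd, fun z =>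
    (e.isOver (ap θ.unop.snd z)).trans (by rw [θ.unop.isOver, res_comp])⟩
  map_id Z := by
    ext e
    exact Elt.ext_ap (res_id X' e.fst) fun _ _ => rfl
  map_comp θ θ' := by
    ext e
    exact Elt.ext_ap (res_comp X' _ _ e.fst) fun _ _ => rfl

variable (b) in
/-- The first projection of a glued presheaf. -/
def gluedFst : glued b ⟶ (proj F).op ⋙ X' where
  app _ := TypeCat.ofHom fun e => e.fst

/-- The value of an element of a glued presheaf. -/
def val {Z : Glueing F} (e : (glued b).obj (op Z)) {c : C} (z : Z.psh.obj (op c)) : X.obj (op c) :=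
  ap (Elt.snd e) z

theorem act_val {Z : Glueing F} (e : (glued b).obj (op Z)) {c : C} (z : Z.psh.obj (op c)) :
    act b (val e z) = res X' (pi z) (act (gluedFst b) e) :=
  Elt.isOver e z

theorem res_val {Z : Glueing F} (e : (glued b).obj (op Z)) {c d : C} (σ : d ⟶ c)
    (z : Z.psh.obj (op c)) : val e (res Z.psh σ z) = res X σ (val e z) :=
  ap_res (Elt.snd e) σ z

theorem glued_ext {Z : Glueing F} {e e' : (glued b).obj (op Z)}
    (h₁ : act (gluedFst b) e = act (gluedFst b) e')
    (h₂ : ∀ (c : C) (z : Z.psh.obj (op c)), val e z = val e' z) : e = e' :=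
  Elt.ext_ap h₁ h₂

theorem val_res {Z Z' : Glueing F} (θ : Z' ⟶ Z) (e : (glued b).obj (op Z)) {c : C}
    (z : Z'.psh.obj (op c)) : val (res (glued b) θ e) z = val e (push θ z) :=
  rfl

variable (b) in
/-- Construction of an element of a glued presheaf. -/
def gluedMk {Z : Glueing F} (fst : X'.obj (op ((proj F).obj Z)))
    (snd : ∀ {c : C}, Z.psh.obj (op c) → X.obj (op c))
    (hres : ∀ {c d : C} (σ : d ⟶ c) (z : Z.psh.obj (op c)),
      snd (res Z.psh σ z) = res X σ (snd z))
    (hact : ∀ {c : C} (z : Z.psh.obj (op c)), act b (snd z) = res X' (pi z) fst) :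
    (glued b).obj (op Z) :=
  ⟨fst, { app := fun _ => TypeCat.ofHom fun z => snd z,
          naturality := fun _ _ σ => by
            ext z
            exact hres σ.unop z }, hact⟩

variable (b) in
/-- The element of a glued presheaf over a representable object given by an element of `X`. -/
def mkElt {c : C} (x : X.obj (op c)) : (glued b).obj (op ((Y F).obj c)) :=
  ⟨act b x, yonedaEquiv.symm x, fun σ => act_res b σ x⟩

theorem val_mkElt {c d : C} (x : X.obj (op c)) (σ : d ⟶ c) :
    val (mkElt b x) (yo σ) = res X σ x :=
  rfl

theorem res_mkElt {c d : C} (σ : d ⟶ c) (x : X.obj (op c)) :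
    res (glued b) ((Y F).map σ) (mkElt b x) = mkElt b (res X σ x) :=
  glued_ext (act_res b σ x).symm fun _ τ => res_comp X τ σ x

theorem res_point {Z : Glueing F} (e : (glued b).obj (op Z)) {c : C} (z : Z.psh.obj (op c)) :
    res (glued b) (point z) e = mkElt b (val e z) :=
  glued_ext (act_val e z).symm fun _ τ => res_val e τ z

theorem val_yo {c d : C} (e : (glued b).obj (op ((Y F).obj c))) (σ : d ⟶ c) :
    val e (yo σ) = res X σ (val e (yo (𝟙 c))) := by
  rw [← res_val, res_yo, Category.comp_id]

theorem fst_eq_act {c : C} (e : (glued b).obj (op ((Y F).obj c))) :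
    act (gluedFst b) e = act b (val e (yo (𝟙 c))) := by
  rw [act_val]
  change _ = res X' (F.map (𝟙 c)) _
  rw [F.map_id]
  exact (res_id X' _).symm

theorem mkElt_bijective (c : C) : Function.Bijective fun x : X.obj (op c) => mkElt b x := by
  constructor
  · intro x x' h
    have val_eq : val (mkElt b x) (yo (𝟙 c)) = val (mkElt b x') (yo (𝟙 c)) :=
      congrArg (fun e : (glued b).obj (op ((Y F).obj c)) => val e (yo (𝟙 c))) h
    rwa [val_mkElt, val_mkElt, res_id, res_id] at val_eq
  · intro e
    exact ⟨val e (yo (𝟙 c)), glued_ext (fst_eq_act e).symm fun d τ => (val_yo e τ).symm⟩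

/-- The action of the embedding on a glued presheaf. -/
def mkEltHom (b : X ⟶ F.op ⋙ X') : X ⟶ (Y F).op ⋙ glued b where
  app c := TypeCat.ofHom fun x => mkElt b (c := c.unop) x
  naturality c d σ := by
    ext x
    exact (res_mkElt σ.unop x).symm

end Glued

/-! ### Families over the glueing category -/

variable {M : Model.{u} S} {D : DispModel F M}

variable (D) in
/-- The types of the terms of the glued type family. -/
def gluedTp : glued D.base.tm ⟶ glued D.base.ty where
  app Z := TypeCat.ofHom fun e => ⟨ap M.tp (Elt.fst e), Elt.snd e ≫ D.tp, fun z =>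
    (D.base.tp_tm (ap (Elt.snd e) z)).symm.trans
      ((congrArg (ap M.tp) (Elt.isOver e z)).trans (ap_res _ _ _))⟩
  naturality Z Z' θ := by
    ext e
    exact Elt.ext_ap (ap_res M.tp _ _) fun _ _ => rfl

variable (D) in
/-- The glued type family. -/
abbrev gluedFamily : TypeFamily.{u} (Glueing F) where
  Ty := glued D.base.ty
  Tm := glued D.base.tm
  tp := gluedTp D

theorem val_tp {Z : Glueing F} (e : (glued D.base.tm).obj (op Z)) {c : C} (z : Z.psh.obj (op c)) :
    val (ap (gluedTp D) e) z = ap D.tp (val e z) :=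
  rfl

theorem tp_mkElt {c : C} (a : D.Tm.obj (op c)) :
    ap (gluedTp D) (mkElt D.base.tm a) = mkElt D.base.ty (ap D.tp a) :=
  glued_ext (D.base.tp_tm a) fun _ σ => ap_res D.tp σ a

variable (D) in
/-- The projection of the glued type family. -/
abbrev gluedBase : FamilyMap (proj F) (gluedFamily D) M.toTypeFamily where
  ty := gluedFst D.base.ty
  tm := gluedFst D.base.tm
  tp_tm _ := rfl

section Families

variable {X : Cᵒᵖ ⥤ Type u} {X' : Sᵒᵖ ⥤ Type u} {b : X ⟶ F.op ⋙ X'} {Z : Glueing F}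
  {A' : (glued D.base.ty).obj (op Z)} {A : M.Ty.obj (op ((proj F).obj Z))}

theorem tp_mkElt_eq {c d : C} {z : Z.psh.obj (op c)} {A₀ : D.Ty.obj (op c)} (e : val A' z = A₀)
    {σ : d ⟶ c} {a : D.Tm.obj (op d)} (h : ap D.tp a = res D.Ty σ A₀) :
    ap (gluedTp D) (mkElt D.base.tm a) =
      res (glued D.base.ty) (point (res Z.psh σ z)) A' := by
  rw [tp_mkElt, h, res_point, res_val, e]

theorem tp_val {Z' : Glueing F} {θ : Z' ⟶ Z} {a : (glued D.base.tm).obj (op Z')}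
    (h : ap (gluedTp D) a = res (glued D.base.ty) θ A') {c : C} (z : Z'.psh.obj (op c)) :
    ap D.tp (val a z) = val A' (push θ z) := by
  rw [← val_tp, h, val_res]

/-- The fiber over an element of `Z.psh` of a family over `Z`. -/
def fiber (B : Fam (gluedFamily D) A' (glued b)) {c : C} (z : Z.psh.obj (op c))
    {A₀ : D.Ty.obj (op c)} (e : val A' z = A₀) : Fam D.toTypeFamily A₀ X where
  val {d} σ a h := val (B.val (point (res Z.psh σ z)) (mkElt D.base.tm a) (tp_mkElt_eq e h))
    (yo (𝟙 d))
  val_res {d d'} τ σ a h := by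
    rw [← val_yo, ← Category.id_comp τ, ← push_Y_map, ← val_res,
      B.val_res ((Y F).map τ) _ _ (tp_mkElt_eq e h), Category.id_comp]
    congr 1
    refine B.val_congr _ ?_ (res_mkElt τ a)
    rw [Y_map_point, res_comp]

theorem val_eq_fiber (B : Fam (gluedFamily D) A' (glued b)) {Z' : Glueing F} (θ : Z' ⟶ Z)
    (a : (glued D.base.tm).obj (op Z')) (h : ap (gluedTp D) a = res (glued D.base.ty) θ A') {c : C}
    (z : Z'.psh.obj (op c)) {A₀ : D.Ty.obj (op c)} (e : val A' (push θ z) = A₀) (h') :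
    val (B.val θ a h) z = (fiber B (push θ z) e).at' (val a z) h' := by
  have val_eq_point :
      val (B.val θ a h) z = val (res (glued b) (point z) (B.val θ a h)) (yo (𝟙 c)) := by
    rw [val_res, push_point, res_id]
  rw [val_eq_point, B.val_res (point z) θ a h]
  change _ = val (B.val _ _ _) _
  congr 1
  refine B.val_congr _ ?_ (res_point a z)
  rw [point_comp, res_id]

theorem val_at' (B : Fam (gluedFamily D) A' (glued b)) (a : (glued D.base.tm).obj (op Z))
    (h : ap (gluedTp D) a = A') {c : C} (z : Z.psh.obj (op c)) {A₀ : D.Ty.obj (op c)}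
    (e : val A' z = A₀) (h') : val (B.at' a h) z = (fiber B z e).at' (val a z) h' :=
  val_eq_fiber B (𝟙 Z) a _ z e h'

theorem fiber_res (B : Fam (gluedFamily D) A' (glued b)) {c d d' : C} (σ : d ⟶ c)
    (z : Z.psh.obj (op c)) {A₀ : D.Ty.obj (op c)} {A₁ : D.Ty.obj (op d)} (e : val A' z = A₀)
    (e' : val A' (res Z.psh σ z) = A₁) (τ : d' ⟶ d) (a : D.Tm.obj (op d')) (h h') :
    (fiber B (res Z.psh σ z) e').val τ a h = (fiber B z e).val (τ ≫ σ) a h' := by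
  change val (B.val _ _ _) _ = val (B.val _ _ _) _
  congr 1
  refine B.val_congr _ ?_ rfl
  rw [res_comp]

theorem fiber_restrict (B : Fam (gluedFamily D) A' (glued b)) {Z' : Glueing F} (θ : Z' ⟶ Z)
    {A'' : (glued D.base.ty).obj (op Z')} (e : res (glued D.base.ty) θ A' = A'') {c d : C}
    (z : Z'.psh.obj (op c)) {A₀ A₁ : D.Ty.obj (op c)} (h₀ : val A'' z = A₀)
    (h₁ : val A' (push θ z) = A₁) (τ : d ⟶ c) (a : D.Tm.obj (op d)) (h h') :
    (fiber (B.restrict θ e) z h₀).val τ a h = (fiber B (push θ z) h₁).val τ a h' := by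
  change val (B.val _ _ _) _ = val (B.val _ _ _) _
  congr 1
  refine B.val_congr _ ?_ rfl
  rw [point_comp, push_res]

theorem act_fiber_ty (hA : act (gluedFst D.base.ty) A' = A) {c : C} (z : Z.psh.obj (op c))
    {A₀ : D.Ty.obj (op c)} (e : val A' z = A₀) : act D.base.ty A₀ = res M.Ty (pi z) A := by
  rw [← e, act_val, hA]

theorem matches_fiber {hA : act (gluedFst D.base.ty) A' = A}
    {B' : Fam (gluedFamily D) A' (glued b)} {B : Fam M.toTypeFamily A X'}
    (hB : (gluedBase D).Matches hA (gluedFst b) B' B) {c : C} (z : Z.psh.obj (op c))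
    {A₀ : D.Ty.obj (op c)} (e : val A' z = A₀) {A₁ : M.Ty.obj (op (F.obj c))}
    (e₁ : res M.Ty (pi z) A = A₁) (h : act D.base.ty A₀ = A₁) :
    D.base.Matches h b (fiber B' z e) (B.restrict (pi z) e₁) := by
  intro d σ a h'
  have fst_eq := hB (point (res Z.psh σ z)) (mkElt D.base.tm a) (tp_mkElt_eq e h')
  exact (B.val_congr _ (pi_res σ z).symm rfl).trans (fst_eq.trans (fst_eq_act _))

theorem fam_ext {hA : act (gluedFst D.base.ty) A' = A} {B₁ B₂ : Fam (gluedFamily D) A' (glued b)}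
    {B : Fam M.toTypeFamily A X'} (h₁ : (gluedBase D).Matches hA (gluedFst b) B₁ B)
    (h₂ : (gluedBase D).Matches hA (gluedFst b) B₂ B)
    (H : ∀ (c : C) (z : Z.psh.obj (op c)), fiber B₁ z rfl = fiber B₂ z rfl) : B₁ = B₂ := by
  refine Fam.ext_val fun Z' θ a h => glued_ext ?_ fun c z => ?_
  · rw [← h₁ θ a h, ← h₂ θ a h]
  · rw [val_eq_fiber B₁ θ a h z rfl (tp_val h z), val_eq_fiber B₂ θ a h z rfl (tp_val h z), H]

/-- The family over a glueing object with given fibers over a given family. -/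
def glueFam (hA : act (gluedFst D.base.ty) A' = A) (B : Fam M.toTypeFamily A X')
    (β : ∀ {c : C} (z : Z.psh.obj (op c)), Fam D.toTypeFamily (val A' z) X)
    (hβ : ∀ {c d : C} (σ : d ⟶ c) (z : Z.psh.obj (op c)) (a : D.Tm.obj (op d)) (h h'),
      (β (res Z.psh σ z)).at' a h = (β z).val σ a h')
    (hβB : ∀ {c : C} (z : Z.psh.obj (op c)),
      D.base.Matches (act_fiber_ty hA z rfl) b (β z) (B.restrict (pi z) rfl)) :
    Fam (gluedFamily D) A' (glued b) where
  val {Z'} θ a h := gluedMk b (B.val ((proj F).map θ) (act (gluedFst D.base.tm) a)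
      ((gluedBase D).tp_tm_eq hA h)) (fun {c} z => (β (push θ z)).at' (val a z) (tp_val h z))
    (fun σ z => by
      have at'_eq : ∀ (z' : Z.psh.obj _) (a' : D.Tm.obj _) (h'), z' = res Z.psh σ (push θ z) →
          a' = res D.Tm σ (val a z) →
          (β z').at' a' h' = res X σ ((β (push θ z)).at' (val a z) (tp_val h z)) := by
        rintro _ _ h' rfl rfl
        rw [Fam.res_at']
        exact hβ _ _ _ _ _
      exact at'_eq _ _ _ (push_res θ σ z) (res_val a σ z))
    (fun {c} z => by
      refine (hβB (push θ z) (𝟙 c) (val a z) (D.toTypeFamily.tp_id (tp_val h z))).symm.trans ?_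
      rw [B.val_res]
      refine B.val_congr _ ?_ (act_val a z)
      rw [F.map_id, Category.id_comp, pi_push])
  val_res {Z₁ Z₂} τ θ a h := by
    refine glued_ext ?_ fun c z => rfl
    rw [act_res]
    refine (B.val_res _ _ _ _).trans ?_
    exact B.val_congr _ ((proj F).map_comp τ θ).symm rfl

section GlueFam

variable {hA : act (gluedFst D.base.ty) A' = A} {B : Fam M.toTypeFamily A X'}
  {β : ∀ {c : C} (z : Z.psh.obj (op c)), Fam D.toTypeFamily (val A' z) X}
  {hβ : ∀ {c d : C} (σ : d ⟶ c) (z : Z.psh.obj (op c)) (a : D.Tm.obj (op d)) (h h'),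
    (β (res Z.psh σ z)).at' a h = (β z).val σ a h'}
  {hβB : ∀ {c : C} (z : Z.psh.obj (op c)),
    D.base.Matches (act_fiber_ty hA z rfl) b (β z) (B.restrict (pi z) rfl)}

theorem matches_glueFam :
    (gluedBase D).Matches hA (gluedFst b) (glueFam hA B β hβ hβB) B :=
  fun _ _ _ _ => rfl

theorem fiber_glueFam {c : C} (z : Z.psh.obj (op c)) :
    fiber (glueFam hA B β hβ hβB) z rfl = β z := by
  refine Fam.ext_val fun d σ a h => ?_
  have at'_eq : ∀ (z' : Z.psh.obj (op d)) (a' : D.Tm.obj (op d)) (h'), z' = res Z.psh σ z →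
      a' = a → (β z').at' a' h' = (β z).val σ a h := by
    rintro _ _ h' rfl rfl
    exact hβ _ _ _ _ _
  exact at'_eq _ _ (tp_val (tp_mkElt_eq rfl h) _) (res_id Z.psh _) (res_id D.Tm a)

end GlueFam

end Families

/-! ### The glued displayed model -/

variable {Z : Glueing F}

section Pi

variable {A : M.Ty.obj (op ((proj F).obj Z))} {A' : (glued D.base.ty).obj (op Z)}

/-- The Π-types of the glued displayed model. -/
def gluedPi (B : Fam M.toTypeFamily A M.Ty) (A' : (glued D.base.ty).obj (op Z))
    (hA : act (gluedFst D.base.ty) A' = A) (B' : Fam (gluedFamily D) A' (glued D.base.ty))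
    (hB : (gluedBase D).Matches hA (gluedFst D.base.ty) B' B) : (glued D.base.ty).obj (op Z) :=
  gluedMk D.base.ty (M.Pi A B)
    (fun z => D.Pi (B.restrict (pi z) rfl) (val A' z) (act_fiber_ty hA z rfl) (fiber B' z rfl)
      (matches_fiber hB z rfl rfl _))
    (fun σ z => by
      rw [D.Pi_res σ _ _ _ _ _ (by rw [act_res, act_fiber_ty hA z rfl])]
      refine D.Pi_congr (res_val A' σ z) (fun Δ τ a h₁ _ => ?_) fun Δ τ a h₁ h₂ => ?_
      · refine B.val_congr _ ?_ rfl
        rw [pi_res, Category.assoc]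
      · exact fiber_res B' σ z rfl rfl τ a h₁ (by rw [res_comp, ← h₂]))
    (fun z => by rw [D.base_Pi, M.Pi_res])

theorem val_gluedPi (B : Fam M.toTypeFamily A M.Ty) (A' : (glued D.base.ty).obj (op Z))
    (hA : act (gluedFst D.base.ty) A' = A) (B' : Fam (gluedFamily D) A' (glued D.base.ty))
    (hB : (gluedBase D).Matches hA (gluedFst D.base.ty) B' B) {c : C} (z : Z.psh.obj (op c)) :
    val (gluedPi B A' hA B' hB) z = D.Pi (B.restrict (pi z) rfl) (val A' z)
      (act_fiber_ty hA z rfl) (fiber B' z rfl) (matches_fiber hB z rfl rfl _) :=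
  rfl

theorem gluedPi_res {Z' : Glueing F} (θ : Z' ⟶ Z)
    (B : Fam M.toTypeFamily A M.Ty) (A' : (glued D.base.ty).obj (op Z))
    (hA : act (gluedFst D.base.ty) A' = A) (B' : Fam (gluedFamily D) A' (glued D.base.ty))
    (hB : (gluedBase D).Matches hA (gluedFst D.base.ty) B' B)
    (hA' : act (gluedFst D.base.ty) (res (glued D.base.ty) θ A') =
      res M.Ty ((proj F).map θ) A) :
    res (glued D.base.ty) θ (gluedPi B A' hA B' hB) =
      gluedPi (B.restrict ((proj F).map θ) rfl) (res (glued D.base.ty) θ A') hA'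
        (B'.restrict θ rfl) (hB.restrict θ rfl rfl hA') := by
  refine glued_ext ((act_res _ _ _).trans (M.Pi_res _ A B)) fun c z => ?_
  rw [val_res, val_gluedPi, val_gluedPi]
  refine D.Pi_congr rfl (fun Δ σ a h₁ _ => ?_) fun Δ σ a h₁ h₂ => ?_
  · refine B.val_congr _ ?_ rfl
    rw [pi_push, Category.assoc]
  · exact (fiber_restrict B' θ rfl z _ _ σ a h₂ h₁).symm

/-- The abstractions of the glued displayed model. -/
def gluedLam (b : Fam M.toTypeFamily A M.Tm) (A' : (glued D.base.ty).obj (op Z))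
    (hA : act (gluedFst D.base.ty) A' = A) (b' : Fam (gluedFamily D) A' (glued D.base.tm))
    (hb : (gluedBase D).Matches hA (gluedFst D.base.tm) b' b) : (glued D.base.tm).obj (op Z) :=
  gluedMk D.base.tm (M.lam A b)
    (fun z => D.lam (b.restrict (pi z) rfl) (val A' z) (act_fiber_ty hA z rfl) (fiber b' z rfl)
      (matches_fiber hb z rfl rfl _))
    (fun σ z => by
      rw [D.lam_res σ _ _ _ _ _ (by rw [act_res, act_fiber_ty hA z rfl])]
      refine D.lam_congr (res_val A' σ z) (fun Δ τ a h₁ _ => ?_) fun Δ τ a h₁ h₂ => ?_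
      · refine b.val_congr _ ?_ rfl
        rw [pi_res, Category.assoc]
      · exact fiber_res b' σ z rfl rfl τ a h₁ (by rw [res_comp, ← h₂]))
    (fun z => by rw [D.base_lam, M.lam_res])

theorem val_gluedLam (b : Fam M.toTypeFamily A M.Tm) (A' : (glued D.base.ty).obj (op Z))
    (hA : act (gluedFst D.base.ty) A' = A) (b' : Fam (gluedFamily D) A' (glued D.base.tm))
    (hb : (gluedBase D).Matches hA (gluedFst D.base.tm) b' b) {c : C} (z : Z.psh.obj (op c)) :
    val (gluedLam b A' hA b' hb) z = D.lam (b.restrict (pi z) rfl) (val A' z)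
      (act_fiber_ty hA z rfl) (fiber b' z rfl) (matches_fiber hb z rfl rfl _) :=
  rfl

theorem gluedLam_res {Z' : Glueing F} (θ : Z' ⟶ Z)
    (b : Fam M.toTypeFamily A M.Tm) (A' : (glued D.base.ty).obj (op Z))
    (hA : act (gluedFst D.base.ty) A' = A) (b' : Fam (gluedFamily D) A' (glued D.base.tm))
    (hb : (gluedBase D).Matches hA (gluedFst D.base.tm) b' b)
    (hA' : act (gluedFst D.base.ty) (res (glued D.base.ty) θ A') =
      res M.Ty ((proj F).map θ) A) :
    res (glued D.base.tm) θ (gluedLam b A' hA b' hb) =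
      gluedLam (b.restrict ((proj F).map θ) rfl) (res (glued D.base.ty) θ A') hA'
        (b'.restrict θ rfl) (hb.restrict θ rfl rfl hA') := by
  refine glued_ext ((act_res _ _ _).trans (M.lam_res _ A b)) fun c z => ?_
  rw [val_res, val_gluedLam, val_gluedLam]
  refine D.lam_congr rfl (fun Δ σ a h₁ _ => ?_) fun Δ σ a h₁ h₂ => ?_
  · refine b.val_congr _ ?_ rfl
    rw [pi_push, Category.assoc]
  · exact (fiber_restrict b' θ rfl z _ _ σ a h₂ h₁).symm

theorem fiber_map_tp (b : Fam (gluedFamily D) A' (glued D.base.tm)) {c : C}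
    (z : Z.psh.obj (op c)) {A₀ : D.Ty.obj (op c)} (e : val A' z = A₀) :
    fiber (b.map (gluedTp D)) z e = (fiber b z e).map D.tp :=
  rfl

/-- `β` is the body of the function `f'` at `z`: a family over the restriction of `b`, valued in the
types of the fiber of `B'`, whose abstraction is the value of `f'` at `z`. -/
structure IsBodyAt (hA : act (gluedFst D.base.ty) A' = A) (b : Fam M.toTypeFamily A M.Tm)
    (B' : Fam (gluedFamily D) A' (glued D.base.ty)) (f' : (glued D.base.tm).obj (op Z)) {c : C}
    (z : Z.psh.obj (op c)) (β : Fam D.toTypeFamily (val A' z) D.Tm) : Prop where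
  map_tp : β.map D.tp = fiber B' z rfl
  matches_base : D.base.Matches (act_fiber_ty hA z rfl) D.base.tm β (b.restrict (pi z) rfl)
  lam_eq : D.lam (b.restrict (pi z) rfl) (val A' z) (act_fiber_ty hA z rfl) β matches_base =
    val f' z

theorem existsUnique_isBodyAt {hA : act (gluedFst D.base.ty) A' = A}
    {B' : Fam (gluedFamily D) A' (glued D.base.ty)} {b : Fam M.toTypeFamily A M.Tm}
    (hB : (gluedBase D).Matches hA (gluedFst D.base.ty) B' (b.map M.tp))
    {f' : (glued D.base.tm).obj (op Z)}
    (hf' : ap (gluedTp D) f' = gluedPi (b.map M.tp) A' hA B' hB)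
    (hf : act (gluedFst D.base.tm) f' = M.lam A b) {c : C} (z : Z.psh.obj (op c)) :
    ∃! β, IsBodyAt hA b B' f' z β := by
  obtain ⟨β, ⟨map_tp, matches_base, lam_eq⟩, huniq⟩ := D.lam_bijective _ (val A' z)
    (act_fiber_ty hA z rfl) (fiber B' z rfl) (matches_fiber hB z rfl rfl _)
    (b.restrict (pi z) rfl) rfl (val f' z) (by rw [← val_tp, hf', val_gluedPi])
    (by rw [act_val, hf, M.lam_res])
  exact ⟨β, ⟨map_tp, matches_base, lam_eq⟩, fun β' h =>
    huniq β' ⟨h.map_tp, h.matches_base, h.lam_eq⟩⟩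

theorem IsBodyAt.restrict {hA : act (gluedFst D.base.ty) A' = A} {b : Fam M.toTypeFamily A M.Tm}
    {B' : Fam (gluedFamily D) A' (glued D.base.ty)} {f' : (glued D.base.tm).obj (op Z)} {c d : C}
    (σ : d ⟶ c) {z : Z.psh.obj (op c)} {β : Fam D.toTypeFamily (val A' z) D.Tm}
    (hβ : IsBodyAt hA b B' f' z β) :
    IsBodyAt hA b B' f' (res Z.psh σ z) (β.restrict σ (res_val A' σ z).symm) where
  map_tp := by
    refine Fam.ext_val fun Δ τ a h => ?_
    have tp_val_eq := congrArg (fun k : Fam D.toTypeFamily (val A' z) D.Ty => k.val (τ ≫ σ) a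
      (by rw [h, res_val, res_comp])) hβ.map_tp
    exact tp_val_eq.trans (fiber_res B' σ z rfl rfl τ a _ _).symm
  matches_base := by
    have matches_restrict := hβ.matches_base.restrict σ (res_val A' σ z).symm
      (A₁' := res M.Ty (pi (res Z.psh σ z)) A) (by rw [pi_res, res_comp])
      (act_fiber_ty hA _ rfl)
    rw [Fam.restrict_restrict] at matches_restrict
    convert matches_restrict using 2
    exact pi_res σ z
  lam_eq := by
    rw [res_val f', ← hβ.lam_eq, D.lam_res σ _ _ _ _ _ (by rw [act_res, act_fiber_ty hA z rfl])]
    refine D.lam_congr (res_val A' σ z) (fun Δ τ a h₁ _ => ?_) fun _ _ _ _ _ => rfl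
    refine b.val_congr _ ?_ rfl
    rw [pi_res, Category.assoc]

theorem gluedLam_bijective (B : Fam M.toTypeFamily A M.Ty) (A' : (glued D.base.ty).obj (op Z))
    (hA : act (gluedFst D.base.ty) A' = A) (B' : Fam (gluedFamily D) A' (glued D.base.ty))
    (hB : (gluedBase D).Matches hA (gluedFst D.base.ty) B' B) (b : Fam M.toTypeFamily A M.Tm)
    (hbB : b.map M.tp = B) (f' : (glued D.base.tm).obj (op Z))
    (hf' : ap (gluedTp D) f' = gluedPi B A' hA B' hB)
    (hf : act (gluedFst D.base.tm) f' = M.lam A b) :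
    ∃! b' : Fam (gluedFamily D) A' (glued D.base.tm), b'.map (gluedTp D) = B' ∧
      ∃ hb : (gluedBase D).Matches hA (gluedFst D.base.tm) b' b, gluedLam b A' hA b' hb = f' := by
  subst hbB
  choose β hβ β_unique using fun c (z : Z.psh.obj (op c)) => existsUnique_isBodyAt hB hf' hf z
  have restrict_β {c d : C} (σ : d ⟶ c) (z : Z.psh.obj (op c)) :
      (β c z).restrict σ (res_val A' σ z).symm = β d (res Z.psh σ z) :=
    β_unique _ _ _ ((hβ c z).restrict σ)
  let b' : Fam (gluedFamily D) A' (glued D.base.tm) := glueFam hA b (fun z => β _ z)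
    (fun σ z a h h' => by rw [← restrict_β, Fam.at'_restrict]) fun z => (hβ _ z).matches_base
  have hb' : (gluedBase D).Matches hA (gluedFst D.base.tm) b' b := matches_glueFam
  have fiber_b' {c : C} (z : Z.psh.obj (op c)) : fiber b' z rfl = β c z := fiber_glueFam z
  refine ⟨b', ⟨?_, hb', ?_⟩, ?_⟩
  · refine fam_ext hb'.mapTp hB fun c z => ?_
    rw [fiber_map_tp, fiber_b', (hβ c z).map_tp]
  · refine glued_ext hf.symm fun c z => ?_
    rw [val_gluedLam, ← (hβ c z).lam_eq]
    exact D.lam_congr rfl (fun _ _ _ _ _ => rfl) fun _ _ _ _ _ => by rw [fiber_b']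
  · rintro b'' ⟨rfl, hb'', rfl⟩
    refine fam_ext hb'' hb' fun c z => ?_
    rw [fiber_b']
    exact β_unique c z _ ⟨rfl, matches_fiber hb'' z rfl rfl _, rfl⟩

end Pi

variable (D Z) in
/-- The type of booleans of the glued displayed model. -/
def gluedBool : (glued D.base.ty).obj (op Z) :=
  gluedMk D.base.ty (M.bool _) (fun {c} _ => D.bool c) (fun σ _ => (D.bool_res σ).symm)
    (fun {c} z => by rw [D.base_bool, M.bool_res])

variable (D Z) in
/-- The value `true` of the glued displayed model. -/
def gluedTt : (glued D.base.tm).obj (op Z) :=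
  gluedMk D.base.tm (M.tt _) (fun {c} _ => D.tt c) (fun σ _ => (D.tt_res σ).symm)
    (fun {c} z => by rw [D.base_tt, M.tt_res])

variable (D Z) in
/-- The value `false` of the glued displayed model. -/
def gluedFf : (glued D.base.tm).obj (op Z) :=
  gluedMk D.base.tm (M.ff _) (fun {c} _ => D.ff c) (fun σ _ => (D.ff_res σ).symm)
    (fun {c} z => by rw [D.base_ff, M.ff_res])

theorem tp_gluedTt (Z : Glueing F) : ap (gluedTp D) (gluedTt D Z) = gluedBool D Z :=
  glued_ext (M.tp_tt _) fun c _ => D.tp_tt c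

theorem tp_gluedFf (Z : Glueing F) : ap (gluedTp D) (gluedFf D Z) = gluedBool D Z :=
  glued_ext (M.tp_ff _) fun c _ => D.tp_ff c

theorem gluedBool_res {Z' : Glueing F} (θ : Z' ⟶ Z) :
    res (glued D.base.ty) θ (gluedBool D Z) = gluedBool D Z' :=
  glued_ext (M.bool_res _) fun _ _ => rfl

theorem fst_gluedBool : act (gluedFst D.base.ty) (gluedBool D Z) = M.bool ((proj F).obj Z) :=
  rfl

theorem val_gluedBool {c : C} (z : Z.psh.obj (op c)) : val (gluedBool D Z) z = D.bool c :=
  rfl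

theorem val_tp_eq_at' {P' : Fam (gluedFamily D) (gluedBool D Z) (glued D.base.ty)}
    {t a : (glued D.base.tm).obj (op Z)}
    {ha : ap (gluedTp D) a = gluedBool D Z} (ht : ap (gluedTp D) t = P'.at' a ha) {c : C}
    (z : Z.psh.obj (op c)) (h' : ap D.tp (val a z) = D.bool c) :
    ap D.tp (val t z) = (fiber P' z (val_gluedBool z)).at' (val a z) h' := by
  rw [← val_tp, ht]
  exact val_at' P' a ha z rfl h'

section BoolElim

variable {P : Fam M.toTypeFamily (M.bool ((proj F).obj Z)) M.Ty}
  {P' : Fam (gluedFamily D) (gluedBool D Z) (glued D.base.ty)}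
  (hP : (gluedBase D).Matches fst_gluedBool (gluedFst D.base.ty) P' P)
  {t f b : (glued D.base.tm).obj (op Z)}
  (ht : ap (gluedTp D) t = P'.at' (gluedTt D Z) (tp_gluedTt Z))
  (hf : ap (gluedTp D) f = P'.at' (gluedFf D Z) (tp_gluedFf Z))
  (hb : ap (gluedTp D) b = gluedBool D Z)

/-- The value at `z` of the eliminator of the booleans of the glued displayed model. -/
def fiberBoolElim {c : C} (z : Z.psh.obj (op c)) : D.Tm.obj (op c) :=
  D.boolElim (P.restrict (pi z) (M.bool_res _)) (fiber P' z (val_gluedBool z))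
    (matches_fiber hP z (val_gluedBool z) _ (D.base_bool c)) (val t z) (val f z) (val b z)
    (val_tp_eq_at' ht z (D.tp_tt c)) (val_tp_eq_at' hf z (D.tp_ff c))
    (by rw [← val_tp, hb, val_gluedBool])

theorem fiberBoolElim_res {c d : C} (σ : d ⟶ c) (z : Z.psh.obj (op c)) :
    fiberBoolElim hP ht hf hb (res Z.psh σ z) = res D.Tm σ (fiberBoolElim hP ht hf hb z) := by
  refine Eq.trans ?_ (D.boolElim_res σ _ _ _ _ _ _ _ _ _
    (Fam.tp_res_eq_at' (val_tp_eq_at' ht z (D.tp_tt c)) σ (D.bool_res σ) (D.tt_res σ) _)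
    (Fam.tp_res_eq_at' (val_tp_eq_at' hf z (D.tp_ff c)) σ (D.bool_res σ) (D.ff_res σ) _)
    (by rw [← res_val, ← val_tp, hb, val_gluedBool])).symm
  refine D.boolElim_congr (fun Δ τ a h => ?_) (fun Δ τ a h => ?_) (res_val t σ z)
    (res_val f σ z) (res_val b σ z)
  · refine P.val_congr _ ?_ rfl
    rw [pi_res, Category.assoc]
  · exact fiber_res P' σ z (val_gluedBool z) _ τ a h (by rw [res_comp, D.bool_res, h])

theorem act_fiberBoolElim {c : C} (z : Z.psh.obj (op c)) :
    act D.base.tm (fiberBoolElim hP ht hf hb z) =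
      res M.Tm (pi z) (M.boolElim P (act (gluedFst D.base.tm) t) (act (gluedFst D.base.tm) f)
        (act (gluedFst D.base.tm) b) (hP.tp_eq_at' ht rfl _) (hP.tp_eq_at' hf rfl _)
        (congrArg (act (gluedFst D.base.ty)) hb)) := by
  have hPz := matches_fiber hP z (val_gluedBool z) (M.bool_res _) (D.base_bool c)
  have tp_t := hPz.tp_eq_at' (val_tp_eq_at' ht z (D.tp_tt c)) (D.base_tt c) (M.tp_tt _)
  have tp_f := hPz.tp_eq_at' (val_tp_eq_at' hf z (D.tp_ff c)) (D.base_ff c) (M.tp_ff _)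
  have tp_b : ap M.tp (act D.base.tm (val b z)) = M.bool _ := by
    rw [D.base.tp_tm, ← val_tp, hb, val_gluedBool, D.base_bool]
  refine (D.base_boolElim _ _ hPz _ _ _ _ _ _ tp_t tp_f tp_b).trans (Eq.trans ?_
    (M.boolElim_res (pi z) P _ _ _ _ _ _ (by rwa [act_val] at tp_t)
      (by rwa [act_val] at tp_f) (by rwa [act_val] at tp_b)).symm)
  congr 1 <;> exact act_val _ z

end BoolElim

/-- The eliminator of the booleans of the glued displayed model. -/
def gluedBoolElim (P : Fam M.toTypeFamily (M.bool ((proj F).obj Z)) M.Ty)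
    (P' : Fam (gluedFamily D) (gluedBool D Z) (glued D.base.ty))
    (hP : (gluedBase D).Matches fst_gluedBool (gluedFst D.base.ty) P' P)
    (t f b : (glued D.base.tm).obj (op Z))
    (ht : ap (gluedTp D) t = P'.at' (gluedTt D Z) (tp_gluedTt Z))
    (hf : ap (gluedTp D) f = P'.at' (gluedFf D Z) (tp_gluedFf Z))
    (hb : ap (gluedTp D) b = gluedBool D Z) : (glued D.base.tm).obj (op Z) :=
  gluedMk D.base.tm (M.boolElim P (act (gluedFst D.base.tm) t) (act (gluedFst D.base.tm) f)
      (act (gluedFst D.base.tm) b) (hP.tp_eq_at' ht rfl _) (hP.tp_eq_at' hf rfl _)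
      (congrArg (act (gluedFst D.base.ty)) hb))
    (fiberBoolElim hP ht hf hb) (fiberBoolElim_res hP ht hf hb) (act_fiberBoolElim hP ht hf hb)

theorem gluedBoolElim_res {Z' : Glueing F} (θ : Z' ⟶ Z)
    (P : Fam M.toTypeFamily (M.bool ((proj F).obj Z)) M.Ty)
    (P' : Fam (gluedFamily D) (gluedBool D Z) (glued D.base.ty))
    (hP : (gluedBase D).Matches fst_gluedBool (gluedFst D.base.ty) P' P)
    (t f b : (glued D.base.tm).obj (op Z)) (ht hf hb ht' hf' hb') :
    res (glued D.base.tm) θ (gluedBoolElim P P' hP t f b ht hf hb) =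
      gluedBoolElim (P.restrict ((proj F).map θ) (M.bool_res _))
        (P'.restrict θ (gluedBool_res θ)) (hP.restrict θ _ _ fst_gluedBool)
        (res (glued D.base.tm) θ t) (res (glued D.base.tm) θ f) (res (glued D.base.tm) θ b)
        ht' hf' hb' := by
  refine glued_ext ((act_res _ _ _).trans (M.boolElim_res _ P _ _ _ _ _ _ _ _ _)) fun c z => ?_
  rw [val_res]
  refine D.boolElim_congr (fun Δ σ a h => ?_) (fun Δ σ a h => ?_) rfl rfl rfl
  · refine P.val_congr _ ?_ rfl
    rw [pi_push, Category.assoc]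
  · exact (fiber_restrict P' θ _ z _ _ σ a h h).symm

variable (D) in
/-- The displayed model over the glueing category. -/
def gluedModel : DispModel (proj F) M where
  toTypeFamily := gluedFamily D
  base := gluedBase D
  Pi := gluedPi
  base_Pi _ _ _ _ _ := rfl
  Pi_res θ := gluedPi_res θ
  lam := gluedLam
  base_lam _ _ _ _ _ := rfl
  lam_res θ := gluedLam_res θ
  tp_lam b A' hA b' hb := glued_ext (M.tp_lam _ b) fun c z => D.tp_lam _ _ _ _ _
  lam_bijective := gluedLam_bijective
  bool Z := gluedBool D Z
  bool_res θ := gluedBool_res θ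
  base_bool _ := rfl
  tt Z := gluedTt D Z
  tt_res θ := glued_ext (M.tt_res _) fun _ _ => rfl
  tp_tt := tp_gluedTt
  base_tt _ := rfl
  ff Z := gluedFf D Z
  ff_res θ := glued_ext (M.ff_res _) fun _ _ => rfl
  tp_ff := tp_gluedFf
  base_ff _ := rfl
  boolElim := gluedBoolElim
  base_boolElim _ _ _ _ _ _ _ _ _ _ _ _ := rfl
  tp_boolElim P P' hP t f b ht hf hb := glued_ext
    ((M.tp_boolElim _ _ _ _ _ _ _).trans (hP.at' b hb _)) fun c z => by
      exact (D.tp_boolElim _ _ _ _ _ _ _ _ _).trans (val_at' P' b hb z _ _).symm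
  boolElim_res := gluedBoolElim_res
  boolElim_tt P P' hP t f ht hf := glued_ext (M.boolElim_tt _ _ _ _ _) fun c z =>
    D.boolElim_tt _ _ _ _ _ _ _
  boolElim_ff P P' hP t f ht hf := glued_ext (M.boolElim_ff _ _ _ _ _) fun c z =>
    D.boolElim_ff _ _ _ _ _ _ _

/-! ### Context extensions of the glued displayed model -/

section Extension

variable (A' : (glued D.base.ty).obj (op Z))

/-- The presheaf of the context extension of `Z` by `A'`. -/
def extPsh : Subfunctor (FunctorToTypes.prod Z.psh D.Tm) where
  obj c := {za | ap D.tp (Γ := c.unop) za.2 = val A' (c := c.unop) za.1}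
  map σ za hza := (ap_res D.tp σ.unop za.2).trans
    ((congrArg (res D.Ty σ.unop) hza).trans (res_val A' σ.unop za.1).symm)

variable {A'} {E : S} {p : E ⟶ (proj F).obj Z} {q : M.Tm.obj (op E)}
  (hE : IsExtension M.tp (act (gluedFst D.base.ty) A') p q)

theorem tp_act_of_tp_eq_val {c : C} (z : Z.psh.obj (op c)) (a : D.Tm.obj (op c))
    (h : ap D.tp a = val A' z) :
    ap M.tp (act D.base.tm a) = res M.Ty (pi z) (act (gluedFst D.base.ty) A') := by
  rw [D.base.tp_tm, h, act_val]

/-- The context extension of `Z` by `A'`. -/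
noncomputable def extObj : Glueing F where
  ctx := E
  psh := (extPsh A').toFunctor
  π za := hE.lift (pi za.1.1) (act D.base.tm za.1.2) (tp_act_of_tp_eq_val _ _ za.2)
  π_res σ za := by
    refine hE.hom_ext ?_ ?_
    · rw [hE.lift_p, Category.assoc, hE.lift_p]
      exact pi_res σ za.1.1
    · rw [hE.res_lift_q, res_comp, hE.res_lift_q]
      exact act_res D.base.tm σ za.1.2

/-- The projection of a context extension. -/
noncomputable def extProj : extObj hE ⟶ Z where
  fst := p
  snd := (extPsh A').ι ≫ FunctorToTypes.prod.fst
  isOver za := (hE.lift_p (pi za.1.1) (act D.base.tm za.1.2) (tp_act_of_tp_eq_val _ _ za.2)).symm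

/-- The generic element of a context extension. -/
noncomputable def extGen : (glued D.base.tm).obj (op (extObj hE)) :=
  gluedMk D.base.tm (Z := extObj hE) q (fun za => za.1.2) (fun _ _ => rfl)
    fun za => (hE.res_lift_q (pi za.1.1) (act D.base.tm za.1.2) (tp_act_of_tp_eq_val _ _ za.2)).symm

theorem isExtension_extObj : IsExtension (gluedTp D) A' (extProj hE) (extGen hE) where
  isOver := glued_ext hE.isOver fun _ za => za.2
  existsUnique_lift {W} θ a h := by
    have tp_fst : ap M.tp (act (gluedFst D.base.tm) a) =
        res M.Ty ((proj F).map θ) (act (gluedFst D.base.ty) A') := (gluedBase D).tp_tm_eq rfl h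
    have lift_push {c : C} (w : W.psh.obj (op c)) :
        hE.lift (pi (push θ w)) (act D.base.tm (val a w)) (tp_act_of_tp_eq_val _ _ (tp_val h w)) =
          pi w ≫ hE.lift ((proj F).map θ) (act (gluedFst D.base.tm) a) tp_fst := by
      refine hE.hom_ext ?_ ?_
      · rw [hE.lift_p, Category.assoc, hE.lift_p, pi_push]
      · rw [hE.res_lift_q, res_comp, hE.res_lift_q, act_val]
    let τ : W ⟶ extObj hE :=
      { fst := hE.lift ((proj F).map θ) (act (gluedFst D.base.tm) a) tp_fst
        snd :=
          { app := fun c => TypeCat.ofHom fun w =>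
              ⟨(push θ (c := c.unop) w, val a (c := c.unop) w), tp_val h _⟩
            naturality := fun c d σ => by
              ext w
              exact Subtype.ext (Prod.ext (push_res θ σ.unop w) (res_val a σ.unop w)) }
        isOver := lift_push }
    refine ⟨τ, ⟨hom_ext (hE.lift_p _ _ tp_fst) fun _ _ => rfl,
      glued_ext (hE.res_lift_q _ _ tp_fst) fun _ _ => rfl⟩, ?_⟩
    rintro τ' ⟨rfl, rfl⟩
    refine hom_ext (hE.hom_ext ?_ ?_) fun _ _ => rfl
    · exact (hE.lift_p _ _ tp_fst).symm
    · exact (hE.res_lift_q _ _ tp_fst).symm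

end Extension

variable (F) in
theorem exists_isTerminal (hS : HasTerminal S) :
    ∃ Z : Glueing F, Nonempty (IsTerminal Z) ∧ Nonempty (IsTerminal ((proj F).obj Z)) := by
  have hT : IsTerminal (⊤_ S) := terminalIsTerminal
  let Z : Glueing F :=
    ⟨⊤_ S, (Functor.const _).obj PUnit, fun _ => hT.from _, fun _ _ => hT.hom_ext _ _⟩
  let toZ (W : Glueing F) : W ⟶ Z :=
    ⟨hT.from _, ⟨fun _ => TypeCat.ofHom fun _ => ⟨⟩, fun _ _ _ => rfl⟩, fun _ => hT.hom_ext _ _⟩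
  exact ⟨Z, ⟨IsTerminal.ofUniqueHom toZ fun _ _ => hom_ext (hT.hom_ext _ _) fun _ _ => rfl⟩, ⟨hT⟩⟩

theorem exists_isExtension (Z : Glueing F) (A' : (glued D.base.ty).obj (op Z)) :
    ∃ (E : Glueing F) (p : E ⟶ Z) (q : (glued D.base.tm).obj (op E)),
      IsExtension (gluedTp D) A' p q ∧
      IsExtension M.tp (act (gluedFst D.base.ty) A') ((proj F).map p)
        (act (gluedFst D.base.tm) q) := by
  obtain ⟨E, p, q, hE⟩ := M.rep _ (act (gluedFst D.base.ty) A')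
  exact ⟨_, _, _, isExtension_extObj hE, hE⟩

theorem hasContextExtensions_gluedModel : (gluedModel D).HasContextExtensions where
  hasTerminal := by
    obtain ⟨Z, ⟨hZ⟩, -⟩ := exists_isTerminal F M.hasTerminal
    exact hZ.hasTerminal
  terminal := by
    obtain ⟨Z, ⟨hZ⟩, ⟨hZ'⟩⟩ := exists_isTerminal F M.hasTerminal
    exact PreservesTerminal.of_isTerminal hZ hZ'
  rep Z A' := by
    obtain ⟨E, p, q, h, -⟩ := exists_isExtension Z A'
    exact ⟨E, p, q, h⟩
  ext := PreservesExtensions.of_exists exists_isExtension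

/-! ### The factorization through the glueing category -/

variable (D) in
/-- The action of the embedding on types and terms. -/
abbrev embedding : FamilyMap (Y F) D.toTypeFamily (gluedFamily D) where
  ty := mkEltHom D.base.ty
  tm := mkEltHom D.base.tm
  tp_tm a := tp_mkElt a

section Fiber

variable {c : C} {A' : D.Ty.obj (op c)} {A'' : (glued D.base.ty).obj (op ((Y F).obj c))}
  {X : Cᵒᵖ ⥤ Type u} {X' : Sᵒᵖ ⥤ Type u} {b : X ⟶ F.op ⋙ X'}

theorem fiber_yo {hA : act (embedding D).ty A' = A''} {B' : Fam D.toTypeFamily A' X}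
    {B'' : Fam (gluedFamily D) A'' (glued b)}
    (hB : (embedding D).Matches hA (mkEltHom b) B' B'') {d d' : C} (σ : d ⟶ c)
    {A₀ : D.Ty.obj (op d)} (e : val A'' (yo σ) = A₀) (τ : d' ⟶ d) (a : D.Tm.obj (op d'))
    (h) (h' : ap D.tp a = res D.Ty (τ ≫ σ) A') :
    (fiber B'' (yo σ) e).val τ a h = B'.val (τ ≫ σ) a h' := by
  have fiber_eq_val :
      (fiber B'' (yo σ) e).val τ a h = val (mkElt b (B'.val (τ ≫ σ) a h')) (yo (𝟙 d')) :=
    congrArg (fun k : (glued b).obj (op ((Y F).obj d')) => val k (yo (𝟙 d')))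
      ((B''.val_congr _ (point_yo (τ ≫ σ)) rfl).trans (hB (τ ≫ σ) a h'))
  rw [fiber_eq_val, val_mkElt, res_id]

end Fiber

section Operations

variable {c : C}

theorem mkElt_bool : mkElt D.base.ty (D.bool c) = gluedBool D ((Y F).obj c) :=
  glued_ext (D.base_bool c) fun _ σ => D.bool_res σ

theorem mkElt_Pi {A : M.Ty.obj (op (F.obj c))} (B : Fam M.toTypeFamily A M.Ty)
    (A' : D.Ty.obj (op c)) (hA : act D.base.ty A' = A) (B' : Fam D.toTypeFamily A' D.Ty)
    (hB : D.base.Matches hA D.base.ty B' B)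
    {B'' : Fam (gluedFamily D) (mkElt D.base.ty A') (glued D.base.ty)}
    (hBB : (embedding D).Matches rfl (embedding D).ty B' B'') (hA'' hB'') :
    mkElt D.base.ty (D.Pi B A' hA B' hB) =
      gluedPi (B.restrict (𝟙 (F.obj c)) rfl) (mkElt D.base.ty A') hA'' B'' hB'' := by
  refine glued_ext ((D.base_Pi B A' hA B' hB).trans
    ((res_id M.Ty _).symm.trans (M.Pi_res (𝟙 (F.obj c)) A B))) fun d (σ : d ⟶ c) => ?_
  refine (D.Pi_res σ B A' hA B' hB (by rw [act_res, hA])).trans ?_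
  refine D.Pi_congr rfl (fun Δ τ a h₁ _ => ?_) fun Δ τ a h₁ h₂ => ?_
  · exact B.val_congr _ (Category.comp_id _).symm rfl
  · exact (fiber_yo hBB σ _ τ a _ _).symm

theorem mkElt_lam {A : M.Ty.obj (op (F.obj c))} (b : Fam M.toTypeFamily A M.Tm)
    (A' : D.Ty.obj (op c)) (hA : act D.base.ty A' = A) (b' : Fam D.toTypeFamily A' D.Tm)
    (hb : D.base.Matches hA D.base.tm b' b)
    {b'' : Fam (gluedFamily D) (mkElt D.base.ty A') (glued D.base.tm)}
    (hbb : (embedding D).Matches rfl (embedding D).tm b' b'') (hA'' hb'') :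
    mkElt D.base.tm (D.lam b A' hA b' hb) =
      gluedLam (b.restrict (𝟙 (F.obj c)) rfl) (mkElt D.base.ty A') hA'' b'' hb'' := by
  refine glued_ext ((D.base_lam b A' hA b' hb).trans
    ((res_id M.Tm _).symm.trans (M.lam_res (𝟙 (F.obj c)) A b))) fun d (σ : d ⟶ c) => ?_
  refine (D.lam_res σ b A' hA b' hb (by rw [act_res, hA])).trans ?_
  refine D.lam_congr rfl (fun Δ τ a h₁ _ => ?_) fun Δ τ a h₁ h₂ => ?_
  · exact b.val_congr _ (Category.comp_id _).symm rfl
  · exact (fiber_yo hbb σ _ τ a _ _).symm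

theorem mkElt_boolElim (Q : Fam M.toTypeFamily (M.bool (F.obj c)) M.Ty)
    (Q' : Fam D.toTypeFamily (D.bool c) D.Ty)
    (hQ : D.base.Matches (D.base_bool c) D.base.ty Q' Q)
    {Q'' : Fam (gluedFamily D) (gluedBool D ((Y F).obj c)) (glued D.base.ty)}
    (hQQ : (embedding D).Matches mkElt_bool (embedding D).ty Q' Q'') (hQ'')
    (t f b : D.Tm.obj (op c)) (ht hf hb ht' hf' hb') :
    mkElt D.base.tm (D.boolElim Q Q' hQ t f b ht hf hb) =
      gluedBoolElim (Q.restrict (𝟙 (F.obj c)) (M.bool_res _)) Q'' hQ'' (mkElt D.base.tm t)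
        (mkElt D.base.tm f) (mkElt D.base.tm b) ht' hf' hb' := by
  have tp_t := hQ.tp_eq_at' ht (D.base_tt c) (M.tp_tt _)
  have tp_f := hQ.tp_eq_at' hf (D.base_ff c) (M.tp_ff _)
  have tp_b : ap M.tp (act D.base.tm b) = M.bool _ := by rw [D.base.tp_tm, hb, D.base_bool]
  refine glued_ext ((D.base_boolElim Q Q' hQ t f b ht hf hb tp_t tp_f tp_b).trans ?_)
    fun d (σ : d ⟶ c) => ?_
  · change _ = M.boolElim (Q.restrict (𝟙 (F.obj c)) (M.bool_res _)) (act D.base.tm t)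
      (act D.base.tm f) (act D.base.tm b) _ _ _
    congr 1
    exact (Q.restrict_id _).symm
  · refine (D.boolElim_res σ Q Q' hQ t f b ht hf hb
      (Fam.tp_res_eq_at' ht σ (D.bool_res σ) (D.tt_res σ) _)
      (Fam.tp_res_eq_at' hf σ (D.bool_res σ) (D.ff_res σ) _)
      (by rw [ap_res, hb, D.bool_res])).trans ?_
    refine D.boolElim_congr (fun Δ τ a h => ?_) (fun Δ τ a h => ?_) rfl rfl rfl
    · exact Q.val_congr _ (Category.comp_id _).symm rfl
    · exact (fiber_yo hQQ σ _ τ a _ _).symm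

end Operations

/-- The factorization of a displayed model without context extensions through the glueing
category. -/
def factorization {C S : Type u} [Category.{u} C] [Category.{u} S] {F : C ⥤ S} {M : Model.{u} S}
    (D : DispModel F M) : Factorization D where
  P := Glueing F
  Y := Y F
  G := proj F
  fac := Iso.refl F
  full := inferInstance
  faithful := inferInstance
  disp := gluedModel D
  hasExt := hasContextExtensions_gluedModel
  map := embedding D
  base_ty _ := (res_id M.Ty _).symm
  base_tm _ := (res_id M.Tm _).symm
  bij_ty := mkElt_bijective
  bij_tm := mkElt_bijective
  Pi B A' hA B' hB _ := mkElt_Pi B A' hA B' hB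
  lam b A' hA b' hb _ := mkElt_lam b A' hA b' hb
  bool _ := mkElt_bool
  tt c := glued_ext (D.base_tt c) fun _ σ => D.tt_res σ
  ff c := glued_ext (D.base_ff c) fun _ σ => D.ff_res σ
  boolElim Q Q' hQ _ := mkElt_boolElim Q Q' hQ

end Glueing

end RelativeInduction

/-- Let `M` be the biinitial model, `𝓡` its category of renamings and `D` a displayed model without
context extensions over `𝓡.F`. The model `D` has factorizations; every factorization has a section
`S₀` of its displayed model with context extensions; and, given displayed interpretations of the
variables in the displayed inserter of `S₀`, there is a relative section `(S₀, α)`, which sends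
every variable to its displayed interpretation. -/
theorem mainTheorem2 {S : Type u} [Category.{u} S] (M : Model.{u} S)
    (hM : Model.IsBiinitial.{u, u, u, u + 1, u} M) {R : Type u} [Category.{u} R]
    (𝓡 : RenamingAlgebra M R) (h𝓡 : 𝓡.IsBiinitial) (D : DispModel 𝓡.F M) :
    Nonempty (Factorization D) ∧
    ∀ 𝓕 : Factorization D, Nonempty (DispSection 𝓕.disp) ∧
      ∀ (S₀ : DispSection 𝓕.disp) (var' : VarInterpretation 𝓡 𝓕 S₀),
        ∃ s : RelativeSection 𝓕 S₀, ∀ (x : R) (a : 𝓡.Var.obj (op x)),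
          s.onTm (act 𝓡.var a) =
            var'.val (s.toInserter.obj x) (act 𝓡.vtp a) (𝟙 x) a (𝓡.vtp_id a) := by
  refine ⟨⟨Glueing.factorization D⟩, fun 𝓕 => ⟨?_, fun S₀ var' => ?_⟩⟩
  · exact Model.IsBiinitial.nonempty_dispSection.{u, u, u + 1, u} hM 𝓕.hasExt
  · exact h𝓡.exists_relativeSection var'
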